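/- Let $n\ge 3$, $\alpha\in(0,n)$, $\sigma_1,\sigma_2\in[0,\alpha)$ and $p,q\in\mathbb{R}$ with $q\ge p>1$ and $\sigma_1\ge\sigma_2$. Let $u,v$ be a positive integrable solution of the integral system $$u(x)=\int_{\mathbb{R}^n}\frac{v(y)^q}{|x-y|^{n-\alpha}|y|^{\sigma_1}}\,dy,\qquad v(x)=\int_{\mathbb{R}^n}\frac{u(y)^p}{|x-y|^{n-\alpha}|y|^{\sigma_2}}\,dy,$$ that is, $u,v$ are real-valued, measurable and positive almost everywhere on $\mathbb{R}^n$, both equations hold for almost every $x\in\mathbb{R}^n$, and $u\in L^{n/q_0}(\mathbb{R}^n)$, $v\in L^{n/p_0}(\mathbb{R}^n)$, where $$p_0=\frac{\alpha(1+p)-(\sigma_2+\sigma_1p)}{pq-1},\qquad q_0=\frac{\alpha(1+q)-(\sigma_1+\sigma_2q)}{pq-1}.$$ Then $u\in L^r(\mathbb{R}^n)$ for every $r$ with $\frac1r\in\left(0,\frac{n-\alpha}{n}\right)$, and $v\in L^s(\mathbb{R}^n)$ for every $s$ with $\frac1s\in\left(0,\min\left\{\frac{n-\alpha}{n},\frac{p(n-\alpha)-(\alpha-\sigma_2)}{n}\right\}\right)$.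 -/

import Mathlib

open MeasureTheory

namespace HardySobolev

noncomputable section

/-- The weighted Riesz potential `x ↦ ∫ f(y) / (|x - y|^(n - α) |y|^σ) dy` over `ℝⁿ` of a
nonnegative function `f`, with values in `[0, ∞]`. The integrand is only altered by the convention
`t / 0 = 0` on the null set `y ∈ {0, x}`. -/
def potential (n : ℕ) (α σ : ℝ) (f : EuclideanSpace ℝ (Fin n) → ℝ)
    (x : EuclideanSpace ℝ (Fin n)) : ENNReal :=
  ∫⁻ y, ENNReal.ofReal (f y / (‖x - y‖ ^ ((n : ℝ) - α) * ‖y‖ ^ σ))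

/-- `(u, v)` is a positive solution of the Hardy–Sobolev type integral system: `u` and `v` are
finite, measurable and positive, and both equations hold (in particular both integrals are finite)
almost everywhere. -/
structure IsPositiveSolution (n : ℕ) (α σ₁ σ₂ p q : ℝ)
    (u v : EuclideanSpace ℝ (Fin n) → ℝ) : Prop where
  aemeasurable_u : AEMeasurable u volume
  aemeasurable_v : AEMeasurable v volume
  pos_u : ∀ᵐ x, 0 < u x
  pos_v : ∀ᵐ x, 0 < v x
  eq_u : ∀ᵐ x, ENNReal.ofReal (u x) = potential n α σ₁ (fun y => v y ^ q) x
  eq_v : ∀ᵐ x, ENNReal.ofReal (v x) = potential n α σ₂ (fun y => u y ^ p) x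

/-- The slow decay rate of `v`. -/
def p₀ (α σ₁ σ₂ p q : ℝ) : ℝ := (α * (1 + p) - (σ₂ + σ₁ * p)) / (p * q - 1)

/-- The slow decay rate of `u`. -/
def q₀ (α σ₁ σ₂ p q : ℝ) : ℝ := (α * (1 + q) - (σ₁ + σ₂ * q)) / (p * q - 1)

/-- `(u, v)` is a positive integrable solution: a positive solution with `u ∈ L^(n/q₀)` and
`v ∈ L^(n/p₀)`. -/
structure IsPositiveIntegrableSolution (n : ℕ) (α σ₁ σ₂ p q : ℝ)
    (u v : EuclideanSpace ℝ (Fin n) → ℝ) : Prop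
    extends IsPositiveSolution n α σ₁ σ₂ p q u v where
  memLp_u : MemLp u (ENNReal.ofReal ((n : ℝ) / q₀ α σ₁ σ₂ p q)) volume
  memLp_v : MemLp v (ENNReal.ofReal ((n : ℝ) / p₀ α σ₁ σ₂ p q)) volume

end

end HardySobolev

/-! Write `T₁`, `T₂` for the two weighted Riesz potentials, so that `u = T₁(v ^ q)` and `v = T₂(u ^
p)`. The analytic input is the Stein–Weiss inequality `exists_powNorm_rieszOp_le`: a potential with
weight `σ` maps `L^s` to `L^t` when `1/s = 1/t + (α - σ)/n` and `0 < 1/t < (n - α)/n`. It follows by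
interpolating two estimates of the kernel on product sets, through the layer cake formula and
duality.

Near the critical exponents the system is linearized: `u = T₁(v^(q-1) · T₂(u^(p-1) · u))`. The
coefficient `v^(q-1)`, restricted to where `v` or `|x|` is large, has small norm in its critical
space, so the restricted operator `S` is a contraction both on the known `L^(r₀)` and on any
admissible `L^r`. The remainder is the potential of a bounded function with bounded support.
`powNorm_ne_top_of_contraction` then puts `u` in `L^r`, and `v` in the `L^s` with `1/r - 1/s = 1/r₀
- 1/s₀`.

Since `p₀ ≤ q₀`, this covers all `1/r` between `(q₀ - p₀)/n` and `(n - α)/n`. One more use of each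
equation gives the smaller `1/r` for `u` and the whole range for `v`. That the critical exponents
are themselves admissible (`q₀ < n - α`) comes from the lower bound `|x|^(α - n)` on potentials. -/

namespace HardySobolev

open Set Metric

open scoped ENNReal

/-! ### Integrals of negative powers of the norm over sets of given measure. -/

section PowerIntegrals

variable {E : Type*} [NormedAddCommGroup E] [NormedSpace ℝ E] [FiniteDimensional ℝ E]
  [MeasurableSpace E] [BorelSpace E] (μ : Measure E) [μ.IsAddHaarMeasure]

/-- Integral of a power of the norm over a ball centred at the origin. -/
theorem exists_lintegral_ball_rpow_le (hd : 1 ≤ Module.finrank ℝ E) {l : ℝ}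
    (hl : l < Module.finrank ℝ E) :
    ∃ C : ℝ, 0 < C ∧ ∀ R : ℝ, 0 < R →
      ∫⁻ y in ball (0 : E) R, ENNReal.ofReal (‖y‖ ^ (-l)) ∂μ ≤
        ENNReal.ofReal (C * R ^ ((Module.finrank ℝ E : ℝ) - l)) := by
  have hint : ∀ R : ℝ, IntegrableOn (fun y : E => ‖y‖ ^ (-l)) (ball (0 : E) R) μ := by
    intro R
    refine integrableOn_ball_of_norm_le_rpow (C := 1) hd hl (Filter.Eventually.of_forall fun x => ?_)
      (measurable_norm.pow_const _).aestronglyMeasurable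
    rw [Real.norm_of_nonneg (by positivity), one_mul]
  -- Scaling reduces to the unit ball; the added `1` makes the constant positive at no cost.
  refine ⟨(∫ y in ball (0 : E) 1, ‖y‖ ^ (-l) ∂μ) + 1, ?_, fun R hR => ?_⟩
  · have : 0 ≤ ∫ y in ball (0 : E) 1, ‖y‖ ^ (-l) ∂μ :=
      integral_nonneg fun y => by positivity
    linarith
  · rw [← ofReal_integral_eq_lintegral_ofReal (hint R)
      (Filter.Eventually.of_forall fun y => by positivity)]
    apply ENNReal.ofReal_le_ofReal
    have h := Measure.setIntegral_comp_smul_of_pos μ (fun y : E => ‖y‖ ^ (-l)) (ball (0 : E) 1) hR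
    rw [smul_unitBall_of_pos hR] at h
    have h2 : ∫ y in ball (0 : E) 1, ‖R • y‖ ^ (-l) ∂μ
        = R ^ (-l) * ∫ y in ball (0 : E) 1, ‖y‖ ^ (-l) ∂μ := by
      rw [← integral_const_mul]
      congr 1 with y
      rw [norm_smul, Real.norm_of_nonneg hR.le, Real.mul_rpow hR.le (norm_nonneg _)]
    rw [h2, smul_eq_mul, eq_comm, inv_mul_eq_iff_eq_mul₀ (by positivity)] at h
    rw [h, sub_eq_add_neg, Real.rpow_add hR, Real.rpow_natCast]
    nlinarith [show 0 < R ^ Module.finrank ℝ E * R ^ (-l) by positivity]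

/-- Among all sets of given measure, the integral of `‖y‖ ^ (-l)` is controlled by the scale
invariant bound attained on balls. -/
theorem exists_setLIntegral_rpow_le (hd : 1 ≤ Module.finrank ℝ E) {l : ℝ} (hl0 : 0 ≤ l)
    (hl : l < Module.finrank ℝ E) :
    ∃ C : ℝ≥0∞, C ≠ ⊤ ∧ ∀ F : Set E,
      ∫⁻ y in F, ENNReal.ofReal (‖y‖ ^ (-l)) ∂μ ≤
        C * μ F ^ (1 - l / Module.finrank ℝ E) := by
  obtain ⟨C, hC, hball⟩ := exists_lintegral_ball_rpow_le μ hd hl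
  have hd0 : (0 : ℝ) < Module.finrank ℝ E := by exact_mod_cast hd
  have hexp : 0 < 1 - l / Module.finrank ℝ E := by
    rw [sub_pos, div_lt_one hd0]; exact hl
  refine ⟨ENNReal.ofReal (C + 1), ENNReal.ofReal_ne_top, fun F => ?_⟩
  rcases eq_or_ne (μ F) 0 with h0 | h0
  · rw [Measure.restrict_eq_zero.2 h0]; simp
  rcases eq_or_ne (μ F) ⊤ with ht | ht
  · rw [ht, ENNReal.top_rpow_of_pos hexp, ENNReal.mul_top]
    · exact le_top
    · simpa using by linarith
  set m := (μ F).toReal with hm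
  have hmpos : 0 < m := ENNReal.toReal_pos h0 ht
  have hmF : μ F = ENNReal.ofReal m := (ENNReal.ofReal_toReal ht).symm
  -- With `R ^ d = m`, the ball of radius `R` has measure comparable to that of `F`. Inside it the
  -- integral over the ball suffices (constant `C`); outside it the integrand is at most `R ^ (-l)`
  -- (the extra `1`).
  set R := m ^ (1 / (Module.finrank ℝ E : ℝ)) with hR
  have hRpos : 0 < R := by positivity
  have hsplit : ∀ y : E, ENNReal.ofReal (‖y‖ ^ (-l)) ≤
      (ball (0 : E) R).indicator (fun y => ENNReal.ofReal (‖y‖ ^ (-l))) y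
        + ENNReal.ofReal (R ^ (-l)) := by
    intro y
    by_cases hy : y ∈ ball (0 : E) R
    · rw [indicator_of_mem hy]; exact le_self_add
    · rw [indicator_of_notMem hy, zero_add]
      apply ENNReal.ofReal_le_ofReal
      apply Real.rpow_le_rpow_of_nonpos hRpos _ (by linarith)
      simpa using hy
  have e1 : R ^ ((Module.finrank ℝ E : ℝ) - l) = m ^ (1 - l / Module.finrank ℝ E) := by
    rw [hR, ← Real.rpow_mul hmpos.le]; congr 1; field_simp
  have e2 : R ^ (-l) * m = m ^ (1 - l / Module.finrank ℝ E) := by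
    rw [hR, ← Real.rpow_mul hmpos.le, sub_eq_add_neg, add_comm, Real.rpow_add hmpos, Real.rpow_one]
    congr 2; field_simp
  calc ∫⁻ y in F, ENNReal.ofReal (‖y‖ ^ (-l)) ∂μ
      ≤ ∫⁻ y in F, ((ball (0 : E) R).indicator (fun y => ENNReal.ofReal (‖y‖ ^ (-l))) y
        + ENNReal.ofReal (R ^ (-l))) ∂μ := lintegral_mono hsplit
    _ = (∫⁻ y in F, (ball (0 : E) R).indicator (fun y => ENNReal.ofReal (‖y‖ ^ (-l))) y ∂μ)
        + ENNReal.ofReal (R ^ (-l)) * μ F := by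
      rw [lintegral_add_right _ measurable_const]; simp
    _ ≤ (∫⁻ y in ball (0 : E) R, ENNReal.ofReal (‖y‖ ^ (-l)) ∂μ)
        + ENNReal.ofReal (R ^ (-l)) * μ F := by
      refine add_le_add ?_ le_rfl
      exact (setLIntegral_le_lintegral F _).trans_eq (lintegral_indicator measurableSet_ball _)
    _ ≤ ENNReal.ofReal (C * R ^ ((Module.finrank ℝ E : ℝ) - l))
        + ENNReal.ofReal (R ^ (-l)) * ENNReal.ofReal m := by
      rw [hmF]; gcongr; exact hball R hRpos
    _ = ENNReal.ofReal (C + 1) * μ F ^ (1 - l / Module.finrank ℝ E) := by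
      rw [← ENNReal.ofReal_mul (by positivity), ← ENNReal.ofReal_add (by positivity) (by positivity),
        e1, e2, hmF, ENNReal.ofReal_rpow_of_pos hmpos, ← ENNReal.ofReal_mul (by positivity)]
      congr 1; ring

theorem exists_setLIntegral_sub_rpow_le (hd : 1 ≤ Module.finrank ℝ E) {l : ℝ} (hl0 : 0 ≤ l)
    (hl : l < Module.finrank ℝ E) :
    ∃ C : ℝ≥0∞, C ≠ ⊤ ∧ ∀ (F : Set E) (x : E),
      ∫⁻ y in F, ENNReal.ofReal (‖x - y‖ ^ (-l)) ∂μ ≤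
        C * μ F ^ (1 - l / Module.finrank ℝ E) := by
  obtain ⟨C, hC, h⟩ := exists_setLIntegral_rpow_le μ hd hl0 hl
  refine ⟨C, hC, fun F x => ?_⟩
  have hmp : MeasurePreserving (fun y : E => y + -x) μ μ := measurePreserving_add_right μ (-x)
  have he : MeasurableEmbedding (fun y : E => y + -x) := measurableEmbedding_addRight (-x)
  have key := hmp.setLIntegral_comp_emb he (fun y => ENNReal.ofReal (‖y‖ ^ (-l))) F
  have hF : μ ((fun y : E => y + -x) '' F) = μ F := by
    rw [← hmp.measure_preimage_emb he, preimage_image_eq _ he.injective]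
  calc ∫⁻ y in F, ENNReal.ofReal (‖x - y‖ ^ (-l)) ∂μ
      = ∫⁻ y in (fun y : E => y + -x) '' F, ENNReal.ofReal (‖y‖ ^ (-l)) ∂μ := by
        rw [← key]
        congr 1 with y
        rw [norm_sub_rev, sub_eq_add_neg]
    _ ≤ _ := by rw [← hF]; exact h _

end PowerIntegrals

/-! ### Off-diagonal interpolation of positive bilinear forms. -/

section Interpolation

theorem lintegral_Ioc_rpow {e R : ℝ} (he : -1 < e) (hR : 0 ≤ R) :
    ∫⁻ b in Ioc (0 : ℝ) R, ENNReal.ofReal (b ^ e) = ENNReal.ofReal (R ^ (e + 1) / (e + 1)) := by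
  have hint : IntegrableOn (fun b : ℝ => b ^ e) (Ioc 0 R) :=
    (intervalIntegrable_iff_integrableOn_Ioc_of_le hR).1 (intervalIntegral.intervalIntegrable_rpow' he)
  rw [← ofReal_integral_eq_lintegral_ofReal hint
    ((ae_restrict_mem measurableSet_Ioc).mono fun b hb => Real.rpow_nonneg hb.1.le _),
    ← intervalIntegral.integral_of_le hR, integral_rpow (Or.inl he),
    Real.zero_rpow (by linarith), sub_zero]

theorem lintegral_Ioi_rpow {e c : ℝ} (he : e < -1) (hc : 0 < c) :
    ∫⁻ a in Ioi c, ENNReal.ofReal (a ^ e) = ENNReal.ofReal (-c ^ (e + 1) / (e + 1)) := by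
  rw [← ofReal_integral_eq_lintegral_ofReal (integrableOn_Ioi_rpow_of_lt he hc)
    ((ae_restrict_mem measurableSet_Ioi).mono fun b hb => Real.rpow_nonneg (hc.trans hb).le _),
    integral_Ioi_rpow_of_lt he hc]

theorem lintegral_Ioi_indicator_rpow_le (c : ℝ≥0∞) {s : ℝ} (hs : 0 < s) :
    ∫⁻ a in Ioi (0 : ℝ), {a : ℝ | ENNReal.ofReal a < c}.indicator
      (fun a => ENNReal.ofReal (a ^ (s - 1))) a ≤ ENNReal.ofReal s⁻¹ * c ^ s := by
  rcases eq_or_ne c ⊤ with rfl | hc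
  · rw [ENNReal.top_rpow_of_pos hs, ENNReal.mul_top (by simpa using hs)]
    exact le_top
  have hm : MeasurableSet {a : ℝ | ENNReal.ofReal a < c} :=
    measurableSet_lt ENNReal.measurable_ofReal measurable_const
  rw [lintegral_indicator hm, Measure.restrict_restrict hm]
  have hsub : {a : ℝ | ENNReal.ofReal a < c} ∩ Ioi 0 ⊆ Ioc 0 c.toReal := fun a ha =>
    ⟨ha.2, ((ENNReal.ofReal_lt_iff_lt_toReal (le_of_lt ha.2) hc).1 ha.1).le⟩
  refine (lintegral_mono_set hsub).trans ?_
  rw [lintegral_Ioc_rpow (by linarith) ENNReal.toReal_nonneg]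
  rw [sub_add_cancel, div_eq_inv_mul, ENNReal.ofReal_mul (by positivity),
    ← ENNReal.ofReal_rpow_of_nonneg ENNReal.toReal_nonneg hs.le, ENNReal.ofReal_toReal hc]

theorem lintegral_Ioi_indicator_one (c : ℝ≥0∞) :
    ∫⁻ a in Ioi (0 : ℝ), {a : ℝ | ENNReal.ofReal a < c}.indicator 1 a = c := by
  have hm : MeasurableSet {a : ℝ | ENNReal.ofReal a < c} :=
    measurableSet_lt ENNReal.measurable_ofReal measurable_const
  rw [lintegral_indicator_one hm, Measure.restrict_apply hm]
  rcases eq_or_ne c ⊤ with rfl | hc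
  · simp
  have : {a : ℝ | ENNReal.ofReal a < c} ∩ Ioi 0 = Ioo 0 c.toReal := by
    ext a
    simp only [mem_inter_iff, mem_ofPred_eq, mem_Ioi, mem_Ioo]
    constructor
    · rintro ⟨h1, h2⟩; exact ⟨h2, (ENNReal.ofReal_lt_iff_lt_toReal h2.le hc).1 h1⟩
    · rintro ⟨h1, h2⟩; exact ⟨(ENNReal.ofReal_lt_iff_lt_toReal h1.le hc).2 h2, h1⟩
  rw [this, Real.volume_Ioo, sub_zero, ENNReal.ofReal_toReal hc]

/-- The layer cake formula for a product of two functions. -/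
theorem lintegral_mul_eq_lintegral_lintegral_measure_prod {X Y : Type*} [MeasurableSpace X]
    [MeasurableSpace Y] (κ : Measure (X × Y)) [SFinite κ] {g : X → ℝ≥0∞} {f : Y → ℝ≥0∞}
    (hg : Measurable g) (hf : Measurable f) :
    ∫⁻ z, g z.1 * f z.2 ∂κ = ∫⁻ a in Ioi (0 : ℝ), ∫⁻ b in Ioi (0 : ℝ),
      κ ({x | ENNReal.ofReal b < g x} ×ˢ {y | ENNReal.ofReal a < f y}) := by
  have hmf : MeasurableSet {w : (X × Y) × ℝ | ENNReal.ofReal w.2 < f w.1.2} :=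
    measurableSet_lt (by fun_prop) (by fun_prop)
  have hmg : MeasurableSet {w : (X × Y) × ℝ | ENNReal.ofReal w.2 < g w.1.1} :=
    measurableSet_lt (by fun_prop) (by fun_prop)
  have hF : Measurable fun w : (X × Y) × ℝ =>
      {a : ℝ | ENNReal.ofReal a < f w.1.2}.indicator (1 : ℝ → ℝ≥0∞) w.2 :=
    (measurable_one.indicator hmf : Measurable ({w : (X × Y) × ℝ | ENNReal.ofReal w.2 < f w.1.2}.indicator
      (1 : (X × Y) × ℝ → ℝ≥0∞)))
  have hG : Measurable fun w : (X × Y) × ℝ =>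
      {a : ℝ | ENNReal.ofReal a < g w.1.1}.indicator (1 : ℝ → ℝ≥0∞) w.2 :=
    (measurable_one.indicator hmg : Measurable ({w : (X × Y) × ℝ | ENNReal.ofReal w.2 < g w.1.1}.indicator
      (1 : (X × Y) × ℝ → ℝ≥0∞)))
  have hI : ∀ c : ℝ≥0∞, Measurable ({a : ℝ | ENNReal.ofReal a < c}.indicator (1 : ℝ → ℝ≥0∞)) :=
    fun c => measurable_one.indicator (measurableSet_lt ENNReal.measurable_ofReal measurable_const)
  calc ∫⁻ z, g z.1 * f z.2 ∂κ
      = ∫⁻ z, (∫⁻ a in Ioi (0 : ℝ), g z.1 *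
          {a : ℝ | ENNReal.ofReal a < f z.2}.indicator 1 a) ∂κ := by
        congr 1 with z
        rw [lintegral_const_mul _ (hI _),
          lintegral_Ioi_indicator_one]
    _ = ∫⁻ a in Ioi (0 : ℝ), ∫⁻ z, g z.1 *
          {a : ℝ | ENNReal.ofReal a < f z.2}.indicator 1 a ∂κ := by
        apply lintegral_lintegral_swap
        exact ((hg.comp (measurable_fst.comp measurable_fst)).mul hF).aemeasurable
    _ = ∫⁻ a in Ioi (0 : ℝ), ∫⁻ z, (∫⁻ b in Ioi (0 : ℝ),
          {a : ℝ | ENNReal.ofReal a < f z.2}.indicator 1 a *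
          {b : ℝ | ENNReal.ofReal b < g z.1}.indicator 1 b) ∂κ := by
        congr 1 with a
        congr 1 with z
        rw [lintegral_const_mul _ (hI _),
          lintegral_Ioi_indicator_one, mul_comm]
    _ = ∫⁻ a in Ioi (0 : ℝ), ∫⁻ b in Ioi (0 : ℝ), ∫⁻ z,
          {a : ℝ | ENNReal.ofReal a < f z.2}.indicator 1 a *
          {b : ℝ | ENNReal.ofReal b < g z.1}.indicator 1 b ∂κ := by
        congr 1 with a
        apply lintegral_lintegral_swap
        exact ((hF.comp (measurable_fst.prodMk measurable_const)).mul hG).aemeasurable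
    _ = _ := by
        congr 1 with a
        congr 1 with b
        rw [← lintegral_indicator_one ((measurableSet_lt measurable_const hg).prod
          (measurableSet_lt measurable_const hf))]
        congr 1 with z
        simp only [indicator, mem_ofPred_eq, mem_prod, Pi.one_apply]
        split_ifs <;> simp_all

/-- Weighted integral of the distribution function. -/
theorem lintegral_Ioi_measure_lt_mul_rpow_le {Y : Type*} [MeasurableSpace Y] (ν : Measure Y)
    [SFinite ν] {f : Y → ℝ≥0∞} (hf : Measurable f) {s : ℝ} (hs : 0 < s) :
    ∫⁻ a in Ioi (0 : ℝ), ENNReal.ofReal (a ^ (s - 1)) * ν {y | ENNReal.ofReal a < f y} ≤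
      ENNReal.ofReal s⁻¹ * ∫⁻ y, f y ^ s ∂ν := by
  have hmf : MeasurableSet {w : ℝ × Y | ENNReal.ofReal w.1 < f w.2} :=
    measurableSet_lt (by fun_prop) (by fun_prop)
  have hF : Measurable fun w : ℝ × Y =>
      {a : ℝ | ENNReal.ofReal a < f w.2}.indicator (fun a => ENNReal.ofReal (a ^ (s - 1))) w.1 :=
    ((by fun_prop : Measurable fun w : ℝ × Y => ENNReal.ofReal (w.1 ^ (s - 1))).indicator hmf :)
  calc ∫⁻ a in Ioi (0 : ℝ), ENNReal.ofReal (a ^ (s - 1)) * ν {y | ENNReal.ofReal a < f y}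
      = ∫⁻ a in Ioi (0 : ℝ), ∫⁻ y,
          {a : ℝ | ENNReal.ofReal a < f y}.indicator
            (fun a => ENNReal.ofReal (a ^ (s - 1))) a ∂ν := by
        congr 1 with a
        rw [← lintegral_indicator_const (measurableSet_lt measurable_const hf)]
        rfl
    _ = ∫⁻ y, (∫⁻ a in Ioi (0 : ℝ),
          {a : ℝ | ENNReal.ofReal a < f y}.indicator
            (fun a => ENNReal.ofReal (a ^ (s - 1))) a) ∂ν :=
        lintegral_lintegral_swap hF.aemeasurable
    _ ≤ ∫⁻ y, ENNReal.ofReal s⁻¹ * f y ^ s ∂ν :=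
        lintegral_mono fun y => lintegral_Ioi_indicator_rpow_le (f y) hs
    _ = _ := lintegral_const_mul _ (hf.pow_const _)


/-- Both factors are dominated by powers of `max A B ≤ 1`, and raising the exponent from `1` to `x +
y` only decreases the value. This turns a product of distribution functions into a sum whose terms
can be integrated separately. -/
theorem rpow_mul_rpow_le_add {A B : ℝ≥0∞} {x y : ℝ} (hA : A ≤ 1) (hB : B ≤ 1)
    (hx : 0 ≤ x) (hy : 0 ≤ y) (hxy : 1 ≤ x + y) : A ^ x * B ^ y ≤ A + B := by
  calc A ^ x * B ^ y ≤ (max A B) ^ x * (max A B) ^ y := by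
        gcongr
        · exact le_max_left _ _
        · exact le_max_right _ _
    _ = (max A B) ^ (x + y) := (ENNReal.rpow_add_of_nonneg _ _ hx hy).symm
    _ ≤ (max A B) ^ (1 : ℝ) := ENNReal.rpow_le_rpow_of_exponent_ge (max_le hA hB) hxy
    _ ≤ A + B := by
        rw [ENNReal.rpow_one]
        exact max_le le_self_add le_add_self

/-- The part of the layer cake integral below the curve `b = a ^ (s / r)`. -/
theorem lintegral_lintegral_rpow_mul_rpow_le {F G : ℝ → ℝ≥0∞} (hF : Measurable F)
    (hG : Measurable G) {s r x y : ℝ} (hs : 0 < s) (hr : 0 < r) (hy : 0 ≤ y)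
    (hsx : 1 < s * x) (hry : r * y < 1) (hxy : x + y = 1 / s + 1 / r) (h1 : 1 ≤ x + y)
    (hF1 : ∀ a, 0 < a → ENNReal.ofReal (a ^ s) * F a ≤ 1)
    (hG1 : ∀ b, 0 < b → ENNReal.ofReal (b ^ r) * G b ≤ 1) :
    ∫⁻ a in Ioi (0 : ℝ), ∫⁻ b in Ioc 0 (a ^ (s / r)), F a ^ x * G b ^ y ≤
      ENNReal.ofReal (1 - r * y)⁻¹ * (∫⁻ a in Ioi (0 : ℝ), ENNReal.ofReal (a ^ (s - 1)) * F a) +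
      ENNReal.ofReal (s * x - 1)⁻¹ * (∫⁻ b in Ioi (0 : ℝ), ENNReal.ofReal (b ^ (r - 1)) * G b) := by
  have hx : 0 ≤ x := by
    by_contra h
    push Not at h
    nlinarith
  -- The previous lemma for `a ^ s * F a` and `b ^ r * G b`, divided by `a ^ (s * x) * b ^ (r * y)`.
  have hpt : ∀ a b : ℝ, 0 < a → 0 < b → F a ^ x * G b ^ y ≤
      ENNReal.ofReal (a ^ (s - s * x)) * F a * ENNReal.ofReal (b ^ (-(r * y))) +
        ENNReal.ofReal (b ^ (r - r * y)) * G b * ENNReal.ofReal (a ^ (-(s * x))) := by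
    intro a b ha hb
    have key := rpow_mul_rpow_le_add (hF1 a ha) (hG1 b hb) hx hy h1
    have ha' : ENNReal.ofReal (a ^ (-(s * x))) * ENNReal.ofReal (a ^ s) ^ x = 1 := by
      rw [ENNReal.ofReal_rpow_of_pos (by positivity), ← Real.rpow_mul ha.le,
        ← ENNReal.ofReal_mul (by positivity), ← Real.rpow_add ha]
      simp
    have hb' : ENNReal.ofReal (b ^ (-(r * y))) * ENNReal.ofReal (b ^ r) ^ y = 1 := by
      rw [ENNReal.ofReal_rpow_of_pos (by positivity), ← Real.rpow_mul hb.le,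
        ← ENNReal.ofReal_mul (by positivity), ← Real.rpow_add hb]
      simp
    have ha2 : ENNReal.ofReal (a ^ (s - s * x)) =
        ENNReal.ofReal (a ^ (-(s * x))) * ENNReal.ofReal (a ^ s) := by
      rw [← ENNReal.ofReal_mul (by positivity), ← Real.rpow_add ha]; ring_nf
    have hb2 : ENNReal.ofReal (b ^ (r - r * y)) =
        ENNReal.ofReal (b ^ (-(r * y))) * ENNReal.ofReal (b ^ r) := by
      rw [← ENNReal.ofReal_mul (by positivity), ← Real.rpow_add hb]; ring_nf
    rw [ENNReal.mul_rpow_of_nonneg _ _ hx, ENNReal.mul_rpow_of_nonneg _ _ hy] at key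
    calc F a ^ x * G b ^ y
        = (ENNReal.ofReal (a ^ (-(s * x))) * ENNReal.ofReal (a ^ s) ^ x) *
          (ENNReal.ofReal (b ^ (-(r * y))) * ENNReal.ofReal (b ^ r) ^ y) *
          (F a ^ x * G b ^ y) := by rw [ha', hb']; simp
      _ = ENNReal.ofReal (a ^ (-(s * x))) * ENNReal.ofReal (b ^ (-(r * y))) *
          (ENNReal.ofReal (a ^ s) ^ x * F a ^ x * (ENNReal.ofReal (b ^ r) ^ y * G b ^ y)) := by
        ring
      _ ≤ ENNReal.ofReal (a ^ (-(s * x))) * ENNReal.ofReal (b ^ (-(r * y))) *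
          (ENNReal.ofReal (a ^ s) * F a + ENNReal.ofReal (b ^ r) * G b) := by gcongr
      _ = _ := by rw [ha2, hb2]; ring
  -- Convergence at `b = 0` is `r * y < 1`; the relation `x + y = 1 / s + 1 / r` makes the resulting
  -- power exactly `a ^ (s - 1)`.
  have hT1 : ∀ a : ℝ, 0 < a →
      ∫⁻ b in Ioc 0 (a ^ (s / r)),
        ENNReal.ofReal (a ^ (s - s * x)) * F a * ENNReal.ofReal (b ^ (-(r * y))) =
      ENNReal.ofReal (1 - r * y)⁻¹ * (ENNReal.ofReal (a ^ (s - 1)) * F a) := by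
    intro a ha
    rw [lintegral_const_mul _ (by fun_prop), lintegral_Ioc_rpow (by linarith) (by positivity),
      mul_right_comm, ← ENNReal.ofReal_mul (by positivity), ← mul_assoc,
      ← ENNReal.ofReal_mul (by rw [inv_nonneg]; linarith)]
    congr 2
    rw [← Real.rpow_mul ha.le, ← mul_div_assoc, ← Real.rpow_add ha, div_eq_inv_mul]
    congr 2
    · ring
    · have : s / r * (-(r * y) + 1) = s / r - s * y := by field_simp; ring
      rw [this]
      have h2 : s * (x + y) = 1 + s / r := by rw [hxy]; field_simp
      linarith
  -- The same region seen from `b` is `a ≥ b ^ (r / s)`, and convergence at infinity is `1 < s * x`.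
  have hT2 : ∀ b : ℝ, 0 < b →
      ∫⁻ a in Ioi (b ^ (r / s)),
        ENNReal.ofReal (b ^ (r - r * y)) * G b * ENNReal.ofReal (a ^ (-(s * x))) =
      ENNReal.ofReal (s * x - 1)⁻¹ * (ENNReal.ofReal (b ^ (r - 1)) * G b) := by
    intro b hb
    rw [lintegral_const_mul _ (by fun_prop), lintegral_Ioi_rpow (by linarith) (by positivity),
      mul_right_comm, ← ENNReal.ofReal_mul (by positivity), ← mul_assoc,
      ← ENNReal.ofReal_mul (by rw [inv_nonneg]; linarith)]
    congr 2
    rw [← Real.rpow_mul hb.le, neg_div, ← div_neg, ← mul_div_assoc, ← Real.rpow_add hb,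
      div_eq_inv_mul]
    congr 2
    · ring
    · have : r / s * (-(s * x) + 1) = r / s - r * x := by field_simp; ring
      rw [this]
      have h2 : r * (x + y) = 1 + r / s := by rw [hxy]; field_simp; ring
      linarith
  have hcurve : ∀ a b : ℝ, 0 < a → 0 < b → (b ≤ a ^ (s / r) ↔ b ^ (r / s) ≤ a) := by
    intro a b ha hb
    rw [← Real.rpow_le_rpow_iff hb.le (by positivity) (show 0 < r / s by positivity),
      ← Real.rpow_mul ha.le]
    have : s / r * (r / s) = 1 := by field_simp
    rw [this, Real.rpow_one]
  have hmset : MeasurableSet {w : ℝ × ℝ | w.2 ∈ Ioc 0 (w.1 ^ (s / r))} :=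
    (measurableSet_lt measurable_const measurable_snd).inter
      (measurableSet_le measurable_snd (by fun_prop))
  calc ∫⁻ a in Ioi (0 : ℝ), ∫⁻ b in Ioc 0 (a ^ (s / r)), F a ^ x * G b ^ y
      ≤ ∫⁻ a in Ioi (0 : ℝ), ((∫⁻ b in Ioc 0 (a ^ (s / r)),
          ENNReal.ofReal (a ^ (s - s * x)) * F a * ENNReal.ofReal (b ^ (-(r * y)))) +
          ∫⁻ b in Ioc 0 (a ^ (s / r)),
          ENNReal.ofReal (b ^ (r - r * y)) * G b * ENNReal.ofReal (a ^ (-(s * x)))) := by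
        refine setLIntegral_mono' measurableSet_Ioi fun a ha => ?_
        rw [← lintegral_add_left (by fun_prop)]
        exact setLIntegral_mono' measurableSet_Ioc fun b hb => hpt a b ha hb.1
    _ = (∫⁻ a in Ioi (0 : ℝ), ENNReal.ofReal (1 - r * y)⁻¹ * (ENNReal.ofReal (a ^ (s - 1)) * F a)) +
        ∫⁻ a in Ioi (0 : ℝ), ∫⁻ b in Ioc 0 (a ^ (s / r)),
          ENNReal.ofReal (b ^ (r - r * y)) * G b * ENNReal.ofReal (a ^ (-(s * x))) := by
        rw [← lintegral_add_left (by fun_prop)]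
        refine setLIntegral_congr_fun measurableSet_Ioi fun a ha => ?_
        simp only [hT1 a ha]
    _ ≤ (∫⁻ a in Ioi (0 : ℝ), ENNReal.ofReal (1 - r * y)⁻¹ * (ENNReal.ofReal (a ^ (s - 1)) * F a)) +
        ∫⁻ b in Ioi (0 : ℝ), ∫⁻ a in Ioi (b ^ (r / s)),
          ENNReal.ofReal (b ^ (r - r * y)) * G b * ENNReal.ofReal (a ^ (-(s * x))) := by
        refine add_le_add le_rfl ?_
        calc ∫⁻ a in Ioi (0 : ℝ), ∫⁻ b in Ioc 0 (a ^ (s / r)),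
              ENNReal.ofReal (b ^ (r - r * y)) * G b * ENNReal.ofReal (a ^ (-(s * x)))
            = ∫⁻ a in Ioi (0 : ℝ), ∫⁻ b in Ioi (0 : ℝ), (Ioc 0 (a ^ (s / r))).indicator (fun b =>
              ENNReal.ofReal (b ^ (r - r * y)) * G b * ENNReal.ofReal (a ^ (-(s * x)))) b := by
              congr 1 with a
              rw [lintegral_indicator measurableSet_Ioc, Measure.restrict_restrict measurableSet_Ioc,
                inter_eq_left.2 Ioc_subset_Ioi_self]
          _ = ∫⁻ b in Ioi (0 : ℝ), ∫⁻ a in Ioi (0 : ℝ), (Ioc 0 (a ^ (s / r))).indicator (fun b =>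
              ENNReal.ofReal (b ^ (r - r * y)) * G b * ENNReal.ofReal (a ^ (-(s * x)))) b := by
              apply lintegral_lintegral_swap
              exact (Measurable.indicator (by fun_prop : Measurable fun w : ℝ × ℝ =>
                ENNReal.ofReal (w.2 ^ (r - r * y)) * G w.2 * ENNReal.ofReal (w.1 ^ (-(s * x))))
                hmset).aemeasurable
          _ ≤ ∫⁻ b in Ioi (0 : ℝ), ∫⁻ a in Ici (b ^ (r / s)),
              ENNReal.ofReal (b ^ (r - r * y)) * G b * ENNReal.ofReal (a ^ (-(s * x))) := by
              refine setLIntegral_mono' measurableSet_Ioi fun b hb => ?_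
              rw [← lintegral_indicator measurableSet_Ioi, ← lintegral_indicator measurableSet_Ici]
              refine lintegral_mono fun a => ?_
              by_cases ha : a ∈ Ioi (0 : ℝ)
              · rw [indicator_of_mem ha]
                by_cases hab : b ∈ Ioc 0 (a ^ (s / r))
                · rw [indicator_of_mem hab, indicator_of_mem]
                  exact (hcurve a b ha hb).1 hab.2
                · rw [indicator_of_notMem hab]; exact zero_le
              · rw [indicator_of_notMem ha]; exact zero_le
          _ = _ := by
              congr 1 with b
              exact setLIntegral_congr Ioi_ae_eq_Ici.symm
    _ = _ := by
        congr 1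
        · rw [lintegral_const_mul _ (by fun_prop)]
        · rw [← lintegral_const_mul _ (by fun_prop)]
          exact setLIntegral_congr_fun measurableSet_Ioi fun b hb => hT2 b hb


variable {X Y : Type*} [MeasurableSpace X] [MeasurableSpace Y]

/-- Bounds of restricted type at two pairs of exponents give a bilinear bound of strong type in
between, when the exponents are off the diagonal. -/
theorem exists_lintegral_mul_le_of_restricted {s r x₁ y₁ x₂ y₂ : ℝ} (hs : 0 < s) (hr : 0 < r)
    (hy₁ : 0 ≤ y₁) (hx₂ : 0 ≤ x₂) (hsx₁ : 1 < s * x₁) (hry₁ : r * y₁ < 1) (hsx₂ : s * x₂ < 1)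
    (hry₂ : 1 < r * y₂) (h₁ : x₁ + y₁ = 1 / s + 1 / r) (h₂ : x₂ + y₂ = 1 / s + 1 / r)
    (h : 1 ≤ 1 / s + 1 / r) (μ : Measure X) (ν : Measure Y) [SFinite μ] [SFinite ν]
    (κ : Measure (X × Y)) [SFinite κ] {C : ℝ≥0∞} (hC : C ≠ ⊤)
    (hκ₁ : ∀ E F, MeasurableSet E → MeasurableSet F → κ (E ×ˢ F) ≤ C * (ν F ^ x₁ * μ E ^ y₁))
    (hκ₂ : ∀ E F, MeasurableSet E → MeasurableSet F → κ (E ×ˢ F) ≤ C * (ν F ^ x₂ * μ E ^ y₂)) :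
    ∃ K : ℝ≥0∞, K ≠ ⊤ ∧ ∀ (g : X → ℝ≥0∞) (f : Y → ℝ≥0∞), Measurable g → Measurable f →
      ∫⁻ x, g x ^ r ∂μ ≤ 1 → ∫⁻ y, f y ^ s ∂ν ≤ 1 → ∫⁻ z, g z.1 * f z.2 ∂κ ≤ K := by
  refine ⟨C * (ENNReal.ofReal (1 - r * y₁)⁻¹ * ENNReal.ofReal s⁻¹ +
      ENNReal.ofReal (s * x₁ - 1)⁻¹ * ENNReal.ofReal r⁻¹) +
    C * (ENNReal.ofReal (1 - s * x₂)⁻¹ * ENNReal.ofReal r⁻¹ +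
      ENNReal.ofReal (r * y₂ - 1)⁻¹ * ENNReal.ofReal s⁻¹), by finiteness, ?_⟩
  intro g f hg hf hg1 hf1
  have hcurve : ∀ a b : ℝ, 0 < a → 0 < b → (b ≤ a ^ (s / r) ↔ b ^ (r / s) ≤ a) := by
    intro a b ha hb
    rw [← Real.rpow_le_rpow_iff hb.le (by positivity) (show 0 < r / s by positivity),
      ← Real.rpow_mul ha.le]
    have : s / r * (r / s) = 1 := by field_simp
    rw [this, Real.rpow_one]
  set F : ℝ → ℝ≥0∞ := fun a => ν {y | ENNReal.ofReal a < f y} with hFdef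
  set G : ℝ → ℝ≥0∞ := fun b => μ {x | ENNReal.ofReal b < g x} with hGdef
  have hF : Measurable F := Antitone.measurable fun a b hab =>
    measure_mono fun y hy => lt_of_le_of_lt (ENNReal.ofReal_le_ofReal hab) hy
  have hG : Measurable G := Antitone.measurable fun a b hab =>
    measure_mono fun y hy => lt_of_le_of_lt (ENNReal.ofReal_le_ofReal hab) hy
  -- Chebyshev's inequality under the normalization `∫ f ^ s ≤ 1`.
  have hF1 : ∀ a, 0 < a → ENNReal.ofReal (a ^ s) * F a ≤ 1 := by
    intro a ha
    refine le_trans ?_ (((mul_meas_ge_le_lintegral (hf.pow_const s) (ENNReal.ofReal (a ^ s)))).trans hf1)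
    refine mul_le_mul_right (measure_mono fun y hy => ?_) _
    rw [mem_ofPred_eq, ← ENNReal.ofReal_rpow_of_pos ha]
    exact ENNReal.rpow_le_rpow (le_of_lt hy) hs.le
  have hG1 : ∀ a, 0 < a → ENNReal.ofReal (a ^ r) * G a ≤ 1 := by
    intro a ha
    refine le_trans ?_ (((mul_meas_ge_le_lintegral (hg.pow_const r) (ENNReal.ofReal (a ^ r)))).trans hg1)
    refine mul_le_mul_right (measure_mono fun y hy => ?_) _
    rw [mem_ofPred_eq, ← ENNReal.ofReal_rpow_of_pos ha]
    exact ENNReal.rpow_le_rpow (le_of_lt hy) hr.le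
  have hFi : ∫⁻ a in Ioi (0 : ℝ), ENNReal.ofReal (a ^ (s - 1)) * F a ≤ ENNReal.ofReal s⁻¹ :=
    (lintegral_Ioi_measure_lt_mul_rpow_le ν hf hs).trans (mul_le_of_le_one_right' hf1)
  have hGi : ∫⁻ a in Ioi (0 : ℝ), ENNReal.ofReal (a ^ (r - 1)) * G a ≤ ENNReal.ofReal r⁻¹ :=
    (lintegral_Ioi_measure_lt_mul_rpow_le μ hg hr).trans (mul_le_of_le_one_right' hg1)
  have hlow := lintegral_lintegral_rpow_mul_rpow_le hF hG hs hr hy₁ hsx₁ hry₁ h₁ (h₁ ▸ h) hF1 hG1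
  -- The region above the curve is `a ≤ b ^ (r / s)`: the same estimate with `f` and `g` exchanged,
  -- now at the second pair of exponents.
  have hupp := lintegral_lintegral_rpow_mul_rpow_le hG hF hr hs hx₂ hry₂ hsx₂
    (by rw [add_comm y₂, h₂, add_comm]) (by rw [add_comm y₂, h₂]; exact h) hG1 hF1
  have hmset : ∀ c : ℝ, MeasurableSet {w : ℝ × ℝ | w.2 ∈ Ioc 0 (w.1 ^ c)} := fun c =>
    (measurableSet_lt measurable_const measurable_snd).inter
      (measurableSet_le measurable_snd (by fun_prop))
  have hind : ∀ c : ℝ, ∀ P : ℝ → ℝ → ℝ≥0∞,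
      ∫⁻ a in Ioi (0 : ℝ), ∫⁻ b in Ioi (0 : ℝ), (Ioc 0 (a ^ c)).indicator (P a) b =
        ∫⁻ a in Ioi (0 : ℝ), ∫⁻ b in Ioc 0 (a ^ c), P a b := by
    intro c P
    congr 1 with a
    rw [lintegral_indicator measurableSet_Ioc, Measure.restrict_restrict measurableSet_Ioc,
      inter_eq_left.2 Ioc_subset_Ioi_self]
  have hP : Measurable fun w : ℝ × ℝ =>
      (Ioc 0 (w.1 ^ (s / r))).indicator (fun b => C * (F w.1 ^ x₁ * G b ^ y₁)) w.2 :=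
    (by fun_prop : Measurable fun w : ℝ × ℝ => C * (F w.1 ^ x₁ * G w.2 ^ y₁)).indicator (hmset _)
  have hQ : Measurable fun w : ℝ × ℝ =>
      (Ioc 0 (w.1 ^ (r / s))).indicator (fun a => C * (G w.1 ^ y₂ * F a ^ x₂)) w.2 :=
    (by fun_prop : Measurable fun w : ℝ × ℝ => C * (G w.1 ^ y₂ * F w.2 ^ x₂)).indicator (hmset _)
  rw [lintegral_mul_eq_lintegral_lintegral_measure_prod κ hg hf]
  calc ∫⁻ a in Ioi (0 : ℝ), ∫⁻ b in Ioi (0 : ℝ),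
        κ ({x | ENNReal.ofReal b < g x} ×ˢ {y | ENNReal.ofReal a < f y})
      ≤ ∫⁻ a in Ioi (0 : ℝ), ∫⁻ b in Ioi (0 : ℝ),
        ((Ioc 0 (a ^ (s / r))).indicator (fun b => C * (F a ^ x₁ * G b ^ y₁)) b +
        (Ioc 0 (b ^ (r / s))).indicator (fun a => C * (G b ^ y₂ * F a ^ x₂)) a) := by
        refine setLIntegral_mono' measurableSet_Ioi fun a ha => ?_
        refine setLIntegral_mono' measurableSet_Ioi fun b hb => ?_
        have hE := measurableSet_lt (measurable_const (a := ENNReal.ofReal b)) hg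
        have hE' := measurableSet_lt (measurable_const (a := ENNReal.ofReal a)) hf
        by_cases hab : b ≤ a ^ (s / r)
        · rw [indicator_of_mem (show b ∈ Ioc 0 (a ^ (s / r)) from ⟨hb, hab⟩)]
          exact (hκ₁ _ _ hE hE').trans le_self_add
        · have hba : a ≤ b ^ (r / s) := by
            rw [hcurve a b ha hb] at hab
            exact (not_le.1 hab).le
          rw [indicator_of_mem (show a ∈ Ioc 0 (b ^ (r / s)) from ⟨ha, hba⟩)]
          refine (hκ₂ _ _ hE hE').trans (le_trans (le_of_eq ?_) le_add_self)
          rw [mul_comm (G b ^ y₂)]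
    _ = (∫⁻ a in Ioi (0 : ℝ), ∫⁻ b in Ioi (0 : ℝ),
          (Ioc 0 (a ^ (s / r))).indicator (fun b => C * (F a ^ x₁ * G b ^ y₁)) b) +
        ∫⁻ b in Ioi (0 : ℝ), ∫⁻ a in Ioi (0 : ℝ),
          (Ioc 0 (b ^ (r / s))).indicator (fun a => C * (G b ^ y₂ * F a ^ x₂)) a := by
        rw [lintegral_lintegral_swap (μ := volume.restrict (Ioi (0 : ℝ)))
          (ν := volume.restrict (Ioi (0 : ℝ)))
          (f := fun b a => (Ioc 0 (b ^ (r / s))).indicator (fun a => C * (G b ^ y₂ * F a ^ x₂)) a)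
          hQ.aemeasurable, ← lintegral_add_left]
        · congr 1 with a
          rw [← lintegral_add_left]
          exact hP.comp (measurable_const.prodMk measurable_id)
        · exact hP.lintegral_prod_right'
    _ = C * (∫⁻ a in Ioi (0 : ℝ), ∫⁻ b in Ioc 0 (a ^ (s / r)), F a ^ x₁ * G b ^ y₁) +
        C * (∫⁻ b in Ioi (0 : ℝ), ∫⁻ a in Ioc 0 (b ^ (r / s)), G b ^ y₂ * F a ^ x₂) := by
        rw [hind, hind]
        simp_rw [lintegral_const_mul' _ _ hC]
    _ ≤ _ := by
        gcongr
        · exact hlow.trans (by gcongr)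
        · exact hupp.trans (by gcongr)

/-- The converse of Hölder's inequality for nonnegative functions. -/
theorem lintegral_rpow_le_of_forall_lintegral_mul_le (μ : Measure X) [SigmaFinite μ] {t r : ℝ}
    (htr : t.HolderConjugate r) {h : X → ℝ≥0∞} (hh : Measurable h) {K : ℝ≥0∞}
    (hK : ∀ g : X → ℝ≥0∞, Measurable g → ∫⁻ x, g x ^ r ∂μ ≤ 1 → ∫⁻ x, g x * h x ∂μ ≤ K) :
    (∫⁻ x, h x ^ t ∂μ) ^ (1 / t) ≤ K := by
  have ht := htr.pos
  have hr := htr.symm.pos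
  -- Truncation in height and support makes `∫ k ^ t` finite, so that it can be divided out;
  -- monotone convergence removes it at the end.
  set k : ℕ → X → ℝ≥0∞ := fun N => (spanningSets μ N).indicator (fun x => min (h x) N) with hk
  have hkm : ∀ N, Measurable (k N) := fun N =>
    (hh.min measurable_const).indicator (measurableSet_spanningSets μ N)
  have hkle : ∀ N x, k N x ≤ h x := fun N x =>
    indicator_apply_le' (fun _ => min_le_left _ _) fun _ => zero_le
  have hkmono : ∀ x, Monotone fun N => k N x := by
    intro x N M hNM
    refine (indicator_le_indicator_of_subset (monotone_spanningSets μ hNM) (fun _ => zero_le) x).trans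
      (indicator_le_indicator ?_)
    exact min_le_min_left _ (by exact_mod_cast hNM)
  have hklim : ∀ x, Filter.Tendsto (fun N => k N x) Filter.atTop (nhds (h x)) := by
    intro x
    have h1 : Filter.Tendsto (fun N : ℕ => min (h x) (N : ℝ≥0∞)) Filter.atTop (nhds (min (h x) ⊤)) :=
      tendsto_const_nhds.min ENNReal.tendsto_nat_nhds_top
    rw [min_top_right] at h1
    refine h1.congr' ?_
    filter_upwards [Filter.eventually_ge_atTop (spanningSetsIndex μ x)] with N hN
    rw [hk]
    simp only
    rw [indicator_of_mem (mem_spanningSets_of_index_le μ x hN)]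
  have hbound : ∀ N, ∫⁻ x, k N x ^ t ∂μ ≤ K ^ t := by
    intro N
    set A := ∫⁻ x, k N x ^ t ∂μ with hA
    have hAtop : A ≠ ⊤ := by
      have : A ≤ ∫⁻ x, (spanningSets μ N).indicator (fun _ => (N : ℝ≥0∞) ^ t) x ∂μ := by
        refine lintegral_mono fun x => ?_
        by_cases hx : x ∈ spanningSets μ N
        · simp only [hk, indicator_of_mem hx]
          exact ENNReal.rpow_le_rpow (min_le_right _ _) ht.le
        · simp only [hk, indicator_of_notMem hx]
          rw [ENNReal.zero_rpow_of_pos ht]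
      refine ne_top_of_le_ne_top ?_ this
      rw [lintegral_indicator_const (measurableSet_spanningSets μ N)]
      exact ENNReal.mul_ne_top (ENNReal.rpow_ne_top_of_nonneg ht.le (ENNReal.natCast_ne_top N))
        (measure_spanningSets_lt_top μ N).ne
    rcases eq_or_ne A 0 with h0 | h0
    · rw [h0]; exact zero_le
    -- The extremal function for Hölder's inequality, normalized by `(t - 1) * r = t`.
    have hg : ∫⁻ x, (A ^ (-(1 / r)) * k N x ^ (t - 1)) ^ r ∂μ ≤ 1 := by
      have : ∀ x, (A ^ (-(1 / r)) * k N x ^ (t - 1)) ^ r = A⁻¹ * k N x ^ t := by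
        intro x
        rw [ENNReal.mul_rpow_of_nonneg _ _ hr.le, ← ENNReal.rpow_mul, ← ENNReal.rpow_mul,
          htr.sub_one_mul_conj, show -(1 / r) * r = -1 by field_simp, ENNReal.rpow_neg_one]
      simp_rw [this]
      rw [lintegral_const_mul _ ((hkm N).pow_const _), ← hA, ENNReal.inv_mul_cancel h0 hAtop]
    have h1 := hK _ (((hkm N).pow_const (t - 1)).const_mul (A ^ (-(1 / r)))) hg
    have h2 : A ^ (1 / t) ≤ ∫⁻ x, A ^ (-(1 / r)) * k N x ^ (t - 1) * h x ∂μ := by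
      calc A ^ (1 / t) = A ^ (-(1 / r)) * A := by
            nth_rewrite 3 [← ENNReal.rpow_one A]
            rw [← ENNReal.rpow_add _ _ h0 hAtop]
            congr 1
            have := htr.inv_add_inv_eq_one
            simp only [one_div]
            linarith
        _ = ∫⁻ x, A ^ (-(1 / r)) * k N x ^ t ∂μ :=
            (lintegral_const_mul _ ((hkm N).pow_const _)).symm
        _ ≤ _ := by
            refine lintegral_mono fun x => ?_
            simp only
            rw [mul_assoc]
            refine mul_le_mul_right ?_ _
            calc k N x ^ t = k N x ^ (t - 1) * k N x ^ (1 : ℝ) := by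
                  rw [← ENNReal.rpow_add_of_nonneg _ _ htr.sub_one_pos.le zero_le_one,
                    sub_add_cancel]
              _ ≤ _ := by rw [ENNReal.rpow_one]; gcongr; exact hkle N x
    have h3 := ENNReal.rpow_le_rpow (h2.trans h1) ht.le
    rwa [← ENNReal.rpow_mul, one_div_mul_cancel ht.ne', ENNReal.rpow_one] at h3
  have hlim := lintegral_tendsto_of_tendsto_of_monotone (μ := μ) (f := fun N x => k N x ^ t)
    (F := fun x => h x ^ t) (fun N => ((hkm N).pow_const _).aemeasurable)
    (Filter.Eventually.of_forall fun x N M hNM => ENNReal.rpow_le_rpow (hkmono x hNM) ht.le)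
    (Filter.Eventually.of_forall fun x => (ENNReal.continuous_rpow_const.tendsto _).comp (hklim x))
  have := ENNReal.rpow_le_rpow (le_of_tendsto' hlim hbound) (show 0 ≤ 1 / t by positivity)
  rwa [← ENNReal.rpow_mul, mul_one_div_cancel ht.ne', ENNReal.rpow_one] at this

/-- Strong type bound for an integral operator with nonnegative kernel from restricted type
bounds. -/
theorem exists_lintegral_kernel_rpow_le_of_restricted {s t r x₁ y₁ x₂ y₂ : ℝ} (hs : 0 < s)
    (htr : t.HolderConjugate r)
    (hy₁ : 0 ≤ y₁) (hx₂ : 0 ≤ x₂) (hsx₁ : 1 < s * x₁) (hry₁ : r * y₁ < 1) (hsx₂ : s * x₂ < 1)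
    (hry₂ : 1 < r * y₂) (h₁ : x₁ + y₁ = 1 / s + 1 / r) (h₂ : x₂ + y₂ = 1 / s + 1 / r)
    (h : 1 ≤ 1 / s + 1 / r) (μ : Measure X) (ν : Measure Y) [SigmaFinite μ] [SFinite ν]
    {k : X → Y → ℝ≥0∞} (hk : Measurable (Function.uncurry k)) {C : ℝ≥0∞} (hC : C ≠ ⊤)
    (hk₁ : ∀ E F, MeasurableSet E → MeasurableSet F →
      ∫⁻ x in E, ∫⁻ y in F, k x y ∂ν ∂μ ≤ C * (ν F ^ x₁ * μ E ^ y₁))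
    (hk₂ : ∀ E F, MeasurableSet E → MeasurableSet F →
      ∫⁻ x in E, ∫⁻ y in F, k x y ∂ν ∂μ ≤ C * (ν F ^ x₂ * μ E ^ y₂)) :
    ∃ K : ℝ≥0∞, K ≠ ⊤ ∧ ∀ f : Y → ℝ≥0∞, Measurable f →
      (∫⁻ x, (∫⁻ y, k x y * f y ∂ν) ^ t ∂μ) ^ (1 / t) ≤ K * (∫⁻ y, f y ^ s ∂ν) ^ (1 / s) := by
  have ht := htr.pos
  have hr := htr.symm.pos
  -- The kernel becomes the density of a measure on the product, whose values on rectangles are the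
  -- restricted bounds.
  have hκ : ∀ E F, MeasurableSet E → MeasurableSet F →
      (μ.prod ν).withDensity (Function.uncurry k) (E ×ˢ F) =
        ∫⁻ x in E, ∫⁻ y in F, k x y ∂ν ∂μ := by
    intro E F hE hF
    rw [withDensity_apply _ (hE.prod hF), ← Measure.prod_restrict, lintegral_prod _ hk.aemeasurable]
    rfl
  obtain ⟨K, hK, hb⟩ := exists_lintegral_mul_le_of_restricted hs hr hy₁ hx₂ hsx₁ hry₁ hsx₂ hry₂ h₁ h₂
    h μ ν ((μ.prod ν).withDensity (Function.uncurry k)) hC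
    (fun E F hE hF => (hκ E F hE hF).le.trans (hk₁ E F hE hF))
    (fun E F hE hF => (hκ E F hE hF).le.trans (hk₂ E F hE hF))
  have hTm : ∀ f : Y → ℝ≥0∞, Measurable f → Measurable fun x => ∫⁻ y, k x y * f y ∂ν :=
    fun f hf => (hk.mul (hf.comp measurable_snd)).lintegral_prod_right'
  have hnorm : ∀ f : Y → ℝ≥0∞, Measurable f → ∫⁻ y, f y ^ s ∂ν ≤ 1 →
      (∫⁻ x, (∫⁻ y, k x y * f y ∂ν) ^ t ∂μ) ^ (1 / t) ≤ K := by
    intro f hf hf1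
    refine lintegral_rpow_le_of_forall_lintegral_mul_le μ htr (hTm f hf) fun g hg hg1 => ?_
    refine le_trans (le_of_eq ?_) (hb g f hg hf hg1 hf1)
    rw [lintegral_withDensity_eq_lintegral_mul _ hk (by fun_prop),
      lintegral_prod _ (by fun_prop)]
    congr 1 with x
    rw [← lintegral_const_mul _ (by fun_prop)]
    congr 1 with y
    simp only [Pi.mul_apply, Function.uncurry]
    ring
  -- `K + 1` is nonzero, so the right-hand side is `⊤` when `∫ f ^ s` is; otherwise homogeneity
  -- reduces to norm one.
  refine ⟨K + 1, by finiteness, fun f hf => ?_⟩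
  set A := ∫⁻ y, f y ^ s ∂ν with hA
  rcases eq_or_ne A ⊤ with hAt | hAt
  · rw [hAt, ENNReal.top_rpow_of_pos (by positivity), ENNReal.mul_top (by simp)]
    exact le_top
  rcases eq_or_ne A 0 with hA0 | hA0
  · have hf0 : f =ᵐ[ν] 0 := by
      rw [hA, lintegral_eq_zero_iff (hf.pow_const s)] at hA0
      filter_upwards [hA0] with y hy
      exact (ENNReal.rpow_eq_zero_iff_of_pos hs).1 hy
    have : ∀ x, ∫⁻ y, k x y * f y ∂ν = 0 := by
      intro x
      rw [← lintegral_zero (μ := ν)]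
      refine lintegral_congr_ae ?_
      filter_upwards [hf0] with y hy
      rw [hy]; simp
    simp_rw [this, ENNReal.zero_rpow_of_pos ht]
    simp [ht]
  set c := A ^ (1 / s) with hc
  have hc0 : c ≠ 0 := by
    rw [hc, Ne, ENNReal.rpow_eq_zero_iff_of_pos (by positivity)]; exact hA0
  have hct : c ≠ ⊤ := ENNReal.rpow_ne_top_of_nonneg (by positivity) hAt
  have hcs : c ^ s = A := by rw [hc, ← ENNReal.rpow_mul, one_div_mul_cancel hs.ne', ENNReal.rpow_one]
  have h1 := hnorm (fun y => c⁻¹ * f y) (by fun_prop) (by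
    simp_rw [ENNReal.mul_rpow_of_nonneg _ _ hs.le]
    rw [lintegral_const_mul _ (by fun_prop), ENNReal.inv_rpow, hcs,
      ENNReal.inv_mul_cancel hA0 hAt])
  have h2 : ∀ x, ∫⁻ y, k x y * f y ∂ν = c * ∫⁻ y, k x y * (c⁻¹ * f y) ∂ν := by
    intro x
    rw [← lintegral_const_mul' _ _ hct]
    congr 1 with y
    rw [mul_left_comm, ← mul_assoc c, ENNReal.mul_inv_cancel hc0 hct, one_mul]
  simp_rw [h2, ENNReal.mul_rpow_of_nonneg _ _ ht.le]
  rw [lintegral_const_mul _ ((hTm _ (by fun_prop)).pow_const _),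
    ENNReal.mul_rpow_of_nonneg _ _ (by positivity), ← ENNReal.rpow_mul, mul_one_div_cancel ht.ne',
    ENNReal.rpow_one, mul_comm]
  gcongr
  exact h1.trans le_self_add

end Interpolation

/-! ### The weighted Riesz potential and the Stein–Weiss inequality. -/

noncomputable section

/-- The kernel `|x - y|^(α - n) |y|^(-σ)` of the weighted Riesz potential. -/
def rieszKernel (n : ℕ) (α σ : ℝ) (x y : EuclideanSpace ℝ (Fin n)) : ℝ≥0∞ :=
  ENNReal.ofReal ((‖x - y‖ ^ ((n : ℝ) - α) * ‖y‖ ^ σ)⁻¹)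

/-- The weighted Riesz potential as an operator on functions with values in `[0, ∞]`. -/
def rieszOp (n : ℕ) (α σ : ℝ) (f : EuclideanSpace ℝ (Fin n) → ℝ≥0∞)
    (x : EuclideanSpace ℝ (Fin n)) : ℝ≥0∞ :=
  ∫⁻ y, rieszKernel n α σ x y * f y

/-- The `L^r` norm of a function with values in `[0, ∞]`. -/
def powNorm {X : Type*} [MeasureSpace X] (r : ℝ) (f : X → ℝ≥0∞) : ℝ≥0∞ :=
  (∫⁻ x, f x ^ r) ^ (1 / r)

variable {n : ℕ} {α σ : ℝ}

theorem measurable_rieszKernel : Measurable (Function.uncurry (rieszKernel n α σ)) := by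
  unfold rieszKernel Function.uncurry
  fun_prop

theorem measurable_rieszOp {f : EuclideanSpace ℝ (Fin n) → ℝ≥0∞} (hf : Measurable f) :
    Measurable (rieszOp n α σ f) :=
  (measurable_rieszKernel.mul (hf.comp measurable_snd)).lintegral_prod_right'

theorem rieszKernel_eq_mul (x y : EuclideanSpace ℝ (Fin n)) :
    rieszKernel n α σ x y =
      ENNReal.ofReal (‖x - y‖ ^ (-((n : ℝ) - α))) * ENNReal.ofReal (‖y‖ ^ (-σ)) := by
  rw [rieszKernel, mul_inv, ENNReal.ofReal_mul (by positivity), ← Real.rpow_neg (norm_nonneg _),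
    ← Real.rpow_neg (norm_nonneg _)]

/-- Replacing the larger base by the smaller one increases a negative power. It splits the kernel
into one singularity at `x` and one at the origin. Zero bases are separate because of the convention
`0 ^ (-c) = 0`. -/
theorem rpow_neg_mul_rpow_neg_le_add {A B c d : ℝ} (hA : 0 ≤ A) (hB : 0 ≤ B) (hc : 0 < c)
    (hd : 0 ≤ d) : A ^ (-c) * B ^ (-d) ≤ A ^ (-(c + d)) + B ^ (-(c + d)) := by
  rcases hA.eq_or_lt with rfl | hA
  · rw [Real.zero_rpow (by linarith)]; simp only [zero_mul]; positivity
  rcases hB.eq_or_lt with rfl | hB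
  · rcases hd.eq_or_lt with rfl | hd
    · simp only [neg_zero, Real.rpow_zero, mul_one, add_zero]
      linarith [Real.rpow_nonneg (le_refl (0 : ℝ)) (-c)]
    · rw [Real.zero_rpow (by linarith : -d ≠ 0)]; simp only [mul_zero]; positivity
  rw [neg_add, Real.rpow_add hA, Real.rpow_add hB]
  rcases le_total A B with h | h
  · have h1 : B ^ (-d) ≤ A ^ (-d) := Real.rpow_le_rpow_of_nonpos hA h (by linarith)
    have h2 : A ^ (-c) * B ^ (-d) ≤ A ^ (-c) * A ^ (-d) := by gcongr
    have h3 : 0 ≤ B ^ (-c) * B ^ (-d) := by positivity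
    linarith
  · have h1 : A ^ (-c) ≤ B ^ (-c) := Real.rpow_le_rpow_of_nonpos hB h (by linarith)
    have h2 : A ^ (-c) * B ^ (-d) ≤ B ^ (-c) * B ^ (-d) := by gcongr
    have h3 : 0 ≤ A ^ (-c) * A ^ (-d) := by positivity
    linarith

/-- The Hardy–Littlewood–Sobolev inequality with one power weight (Stein–Weiss inequality). -/
theorem exists_powNorm_rieszOp_le (hα : α ∈ Ioo (0 : ℝ) n) (hσ : σ ∈ Ico 0 α) {t s : ℝ}
    (ht : 1 / t ∈ Ioo (0 : ℝ) ((n - α) / n)) (hs : 1 / s = 1 / t + (α - σ) / n) :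
    ∃ K : ℝ≥0∞, K ≠ ⊤ ∧ ∀ f : EuclideanSpace ℝ (Fin n) → ℝ≥0∞, Measurable f →
      powNorm t (rieszOp n α σ f) ≤ K * powNorm s f := by
  obtain ⟨hα0, hαn⟩ := hα
  obtain ⟨hσ0, hσα⟩ := hσ
  obtain ⟨ht0, ht1⟩ := ht
  have hn : (0 : ℝ) < n := hα0.trans hαn
  have hfr : Module.finrank ℝ (EuclideanSpace ℝ (Fin n)) = n := finrank_euclideanSpace_fin
  have hd : 1 ≤ Module.finrank ℝ (EuclideanSpace ℝ (Fin n)) := by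
    rw [hfr]; exact_mod_cast hn
  obtain ⟨C₁, hC₁, h₁⟩ := exists_setLIntegral_sub_rpow_le
    (volume : Measure (EuclideanSpace ℝ (Fin n))) hd (l := n - α) (by linarith)
    (by rw [hfr]; linarith)
  obtain ⟨C₂, hC₂, h₂⟩ := exists_setLIntegral_rpow_le
    (volume : Measure (EuclideanSpace ℝ (Fin n))) hd (l := σ) hσ0 (by rw [hfr]; linarith)
  obtain ⟨C₃, hC₃, h₃⟩ := exists_setLIntegral_sub_rpow_le
    (volume : Measure (EuclideanSpace ℝ (Fin n))) hd (l := n - α + σ) (by linarith)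
    (by rw [hfr]; linarith)
  obtain ⟨C₄, hC₄, h₄⟩ := exists_setLIntegral_rpow_le
    (volume : Measure (EuclideanSpace ℝ (Fin n))) hd (l := n - α + σ) (by linarith)
    (by rw [hfr]; linarith)
  rw [hfr] at h₁ h₂ h₃ h₄
  have e₁ : 1 - ((n : ℝ) - α) / n = α / n := by field_simp; ring
  have e₃ : 1 - ((n : ℝ) - α + σ) / n = (α - σ) / n := by field_simp; ring
  rw [e₁] at h₁
  rw [e₃] at h₃ h₄
  have hασ : 0 < (α - σ) / n := div_pos (by linarith) hn
  have hs0 : 0 < 1 / s := by rw [hs]; linarith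
  have ht0' : 0 < t := one_div_pos.1 ht0
  have hs0' : 0 < s := one_div_pos.1 hs0
  have hα1 : ((n : ℝ) - α) / n < 1 := by rw [div_lt_one hn]; linarith
  have hαe : ((n : ℝ) - α) / n = 1 - α / n := by field_simp
  have hαse : (α - σ) / (n : ℝ) = α / n - σ / n := by ring
  have hαn0 : 0 < α / (n : ℝ) := by positivity
  set r := (1 - 1 / t)⁻¹ with hr
  have hr1 : 1 / r = 1 - 1 / t := by rw [hr, one_div, inv_inv]
  have hr0 : 0 < r := by rw [hr]; exact inv_pos.2 (by linarith)
  have htr : t.HolderConjugate r := by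
    rw [Real.holderConjugate_iff]
    refine ⟨?_, by rw [← one_div, ← one_div, hr1]; ring⟩
    exact (div_lt_one ht0').1 (ht1.trans hα1)
  have key : ∀ {a b : ℝ}, 0 < a → (1 < a * b ↔ 1 / a < b) := fun ha => by
    rw [div_lt_iff₀ ha, mul_comm]
  have key' : ∀ {a b : ℝ}, 0 < a → (a * b < 1 ↔ b < 1 / a) := fun ha => by
    rw [lt_div_iff₀ ha, mul_comm]
  -- The first pair comes from integrating the kernel in `x` first, the second from a bound on the
  -- `y`-integral uniform in `x`. The condition `0 < 1 / t < (n - α) / n` says exactly that `(1 / s,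
  -- 1 / r)` lies strictly between the two pairs.
  refine exists_lintegral_kernel_rpow_le_of_restricted (C := C₁ * C₂ + C₃ + C₄)
    (x₁ := 1 - σ / n) (y₁ := α / n) (x₂ := (α - σ) / n) (y₂ := 1) hs0' htr hαn0.le hασ.le
    ((key hs0').2 (by rw [hs]; linarith)) ((key' hr0).2 (by rw [hr1]; linarith))
    ((key' hs0').2 (by rw [hs]; linarith)) ((key hr0).2 (by rw [hr1]; linarith))
    (by rw [hs, hr1]; linarith) (by rw [hs, hr1]; linarith) (by rw [hs, hr1]; linarith) volume volume
    measurable_rieszKernel (by finiteness) ?_ ?_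
  · intro A F hA hF
    rw [lintegral_lintegral_swap measurable_rieszKernel.aemeasurable]
    calc ∫⁻ y in F, ∫⁻ x in A, rieszKernel n α σ x y
        ≤ ∫⁻ y in F, C₁ * volume A ^ (α / n) * ENNReal.ofReal (‖y‖ ^ (-σ)) := by
          refine lintegral_mono fun y => ?_
          simp_rw [rieszKernel_eq_mul]
          rw [lintegral_mul_const' _ _ ENNReal.ofReal_ne_top]
          refine mul_le_mul_left ?_ _
          simp_rw [norm_sub_rev _ y]
          exact h₁ A y
      _ = C₁ * volume A ^ (α / n) * ∫⁻ y in F, ENNReal.ofReal (‖y‖ ^ (-σ)) :=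
          lintegral_const_mul _ (by fun_prop)
      _ ≤ C₁ * volume A ^ (α / n) * (C₂ * volume F ^ (1 - σ / n)) := by gcongr; exact h₂ F
      _ = C₁ * C₂ * (volume F ^ (1 - σ / n) * volume A ^ (α / n)) := by ring
      _ ≤ _ := by
          gcongr
          rw [add_assoc]
          exact le_self_add
  · intro A F hA hF
    calc ∫⁻ x in A, ∫⁻ y in F, rieszKernel n α σ x y
        ≤ ∫⁻ x in A, (C₃ + C₄) * volume F ^ ((α - σ) / n) := by
          refine lintegral_mono fun x => ?_
          calc ∫⁻ y in F, rieszKernel n α σ x y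
              ≤ ∫⁻ y in F, (ENNReal.ofReal (‖x - y‖ ^ (-((n : ℝ) - α + σ))) +
                  ENNReal.ofReal (‖y‖ ^ (-((n : ℝ) - α + σ)))) := by
                refine lintegral_mono fun y => ?_
                rw [rieszKernel_eq_mul, ← ENNReal.ofReal_mul (by positivity),
                  ← ENNReal.ofReal_add (by positivity) (by positivity)]
                exact ENNReal.ofReal_le_ofReal (rpow_neg_mul_rpow_neg_le_add (norm_nonneg _)
                  (norm_nonneg _) (by linarith) hσ0)
            _ = (∫⁻ y in F, ENNReal.ofReal (‖x - y‖ ^ (-((n : ℝ) - α + σ)))) +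
                  ∫⁻ y in F, ENNReal.ofReal (‖y‖ ^ (-((n : ℝ) - α + σ))) :=
                lintegral_add_left (by fun_prop) _
            _ ≤ _ := by rw [add_mul]; exact add_le_add (h₃ F x) (h₄ F)
      _ = (C₃ + C₄) * (volume F ^ ((α - σ) / n) * volume A ^ (1 : ℝ)) := by
          rw [setLIntegral_const, ENNReal.rpow_one, mul_assoc]
      _ ≤ _ := by
          refine mul_le_mul_left ?_ _
          rw [add_assoc]
          exact le_add_self

end

/-! ### Norms of functions with values in `[0, ∞]` and regularity lifting. -/

noncomputable section

section PowNorm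

variable {X : Type*} [MeasureSpace X]

theorem powNorm_mono_ae {r : ℝ} (hr : 0 ≤ r) {f g : X → ℝ≥0∞} (h : ∀ᵐ x, f x ≤ g x) :
    powNorm r f ≤ powNorm r g :=
  ENNReal.rpow_le_rpow (lintegral_mono_ae (h.mono fun _ hx => ENNReal.rpow_le_rpow hx hr))
    (by positivity)

theorem powNorm_congr_ae {r : ℝ} {f g : X → ℝ≥0∞} (h : ∀ᵐ x, f x = g x) :
    powNorm r f = powNorm r g := by
  unfold powNorm
  congr 1
  exact lintegral_congr_ae (h.mono fun _ hx => by simp only [hx])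

theorem powNorm_add_le {r : ℝ} (hr : 1 ≤ r) {f g : X → ℝ≥0∞} (hf : Measurable f)
    (hg : Measurable g) : powNorm r (f + g) ≤ powNorm r f + powNorm r g :=
  ENNReal.lintegral_Lp_add_le hf.aemeasurable hg.aemeasurable hr

/-- Hölder's inequality. -/
theorem powNorm_mul_le {r a b : ℝ} (hr : 0 < r) (ha : 0 < a) (hb : 0 < b)
    (h : 1 / r = 1 / a + 1 / b) {f g : X → ℝ≥0∞} (hf : Measurable f) (hg : Measurable g) :
    powNorm r (fun x => f x * g x) ≤ powNorm a f * powNorm b g := by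
  refine ENNReal.lintegral_Lp_mul_le_Lq_mul_Lr hr ?_ h volume hf.aemeasurable hg.aemeasurable
  rw [← one_div_lt_one_div ha hr, h]
  have : 0 < 1 / b := by positivity
  linarith

theorem powNorm_rpow {r e : ℝ} (he : 0 < e) (f : X → ℝ≥0∞) :
    powNorm r (fun x => f x ^ e) = powNorm (e * r) f ^ e := by
  unfold powNorm
  simp_rw [← ENNReal.rpow_mul]
  congr 1
  rcases eq_or_ne r 0 with rfl | hr
  · simp
  · field_simp

theorem powNorm_ne_top_iff {r : ℝ} (hr : 0 < r) {f : X → ℝ≥0∞} :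
    powNorm r f ≠ ⊤ ↔ ∫⁻ x, f x ^ r ≠ ⊤ := by
  unfold powNorm
  rw [Ne, ENNReal.rpow_eq_top_iff_of_pos (by positivity)]

theorem ae_eq_zero_of_powNorm_eq_zero {r : ℝ} (hr : 0 < r) {f : X → ℝ≥0∞} (hf : Measurable f)
    (h : powNorm r f = 0) : ∀ᵐ x, f x = 0 := by
  unfold powNorm at h
  rw [ENNReal.rpow_eq_zero_iff_of_pos (by positivity), lintegral_eq_zero_iff (hf.pow_const r)] at h
  exact h.mono fun x hx => (ENNReal.rpow_eq_zero_iff_of_pos hr).1 hx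

theorem powNorm_iSup_le {r : ℝ} (hr : 0 < r) {f : ℕ → X → ℝ≥0∞} (hf : ∀ k, Measurable (f k))
    (hmono : Monotone f) {C : ℝ≥0∞} (h : ∀ k, powNorm r (f k) ≤ C) :
    powNorm r (fun x => ⨆ k, f k x) ≤ C := by
  have h1 : ∀ k, ∫⁻ x, f k x ^ r ≤ C ^ r := fun k => by
    have := ENNReal.rpow_le_rpow (h k) hr.le
    rwa [powNorm, ← ENNReal.rpow_mul, one_div_mul_cancel hr.ne', ENNReal.rpow_one] at this
  have h2 : ∀ x, (⨆ k, f k x) ^ r = ⨆ k, f k x ^ r := fun x =>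
    (ENNReal.orderIsoRpow r hr).map_iSup _
  unfold powNorm
  simp_rw [h2]
  rw [lintegral_iSup (fun k => (hf k).pow_const r)
    fun i j hij x => ENNReal.rpow_le_rpow (hmono hij x) hr.le]
  have := ENNReal.rpow_le_rpow (iSup_le h1) (show 0 ≤ 1 / r by positivity)
  rwa [← ENNReal.rpow_mul, mul_one_div_cancel hr.ne', ENNReal.rpow_one] at this

/-- Regularity lifting: a fixed point inequality for a monotone sublinear map that contracts
both the norm in which `U` is known to be finite and another one in which `H` is finite. -/
theorem powNorm_ne_top_of_contraction {S : (X → ℝ≥0∞) → X → ℝ≥0∞}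
    (hSm : ∀ f, Measurable f → Measurable (S f))
    (hmono : ∀ f g, (∀ᵐ x, f x ≤ g x) → S f ≤ S g)
    (hadd : ∀ f g, Measurable f → Measurable g → S (f + g) ≤ S f + S g)
    {r r₀ : ℝ} (hr : 1 ≤ r) (hr₀ : 0 < r₀)
    (hSr : ∀ f, Measurable f → powNorm r (S f) ≤ 2⁻¹ * powNorm r f)
    (hSr₀ : ∀ f, Measurable f → powNorm r₀ (S f) ≤ 2⁻¹ * powNorm r₀ f)
    {U H : X → ℝ≥0∞} (hU : Measurable U) (hH : Measurable H)
    (hUS : ∀ᵐ x, U x ≤ S U x + H x) (hU₀ : powNorm r₀ U ≠ ⊤) (hHr : powNorm r H ≠ ⊤) :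
    powNorm r U ≠ ⊤ := by
  -- Picard iteration from `0`: increasing, and bounded by `2 * powNorm r H` since `S` halves the
  -- norm.
  let W : ℕ → X → ℝ≥0∞ := fun k => Nat.rec 0 (fun _ w => S w + H) k
  have hW0 : W 0 = 0 := rfl
  have hWs : ∀ k, W (k + 1) = S (W k) + H := fun k => rfl
  have hWm : ∀ k, Measurable (W k) := by
    intro k
    induction k with
    | zero => rw [hW0]; exact measurable_zero
    | succ k ih => rw [hWs]; exact (hSm _ ih).add hH
  have hSkm : ∀ k, Measurable (S^[k] U) := by
    intro k
    induction k with
    | zero => exact hU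
    | succ k ih => rw [Function.iterate_succ_apply']; exact hSm _ ih
  have hWmono : Monotone W := by
    refine monotone_nat_of_le_succ fun k => ?_
    induction k with
    | zero => rw [hW0]; exact fun x => zero_le
    | succ k ih =>
      rw [hWs k, hWs (k + 1)]
      exact add_le_add (hmono _ _ (Filter.Eventually.of_forall ih)) le_rfl
  have hWr : ∀ k, powNorm r (W k) ≤ 2 * powNorm r H := by
    intro k
    induction k with
    | zero =>
      have : powNorm r (W 0) = 0 := by
        rw [hW0, powNorm]
        simp [ENNReal.zero_rpow_of_pos (show 0 < r by linarith), (show 0 < r by linarith)]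
      rw [this]; exact zero_le
    | succ k ih =>
      rw [hWs]
      calc powNorm r (S (W k) + H) ≤ powNorm r (S (W k)) + powNorm r H :=
            powNorm_add_le hr (hSm _ (hWm k)) hH
        _ ≤ 2⁻¹ * (2 * powNorm r H) + powNorm r H := by
            gcongr
            exact (hSr _ (hWm k)).trans (by gcongr)
        _ = 2 * powNorm r H := by
            rw [← mul_assoc, ENNReal.inv_mul_cancel (by simp) (by simp), one_mul, two_mul]
  have hUW : ∀ k, ∀ᵐ x, U x ≤ S^[k] U x + W k x := by
    intro k
    induction k with
    | zero => exact Filter.Eventually.of_forall fun x => le_self_add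
    | succ k ih =>
      filter_upwards [hUS] with x hx
      -- An inequality almost everywhere between arguments yields one at every point between images,
      -- so no further null set arises here.
      have h1 := (hmono U (S^[k] U + W k) ih x).trans (hadd _ _ (hSkm k) (hWm k) x)
      rw [Function.iterate_succ_apply', hWs]
      calc U x ≤ S U x + H x := hx
        _ ≤ (S (S^[k] U) + S (W k)) x + H x := add_le_add h1 le_rfl
        _ = _ := by simp only [Pi.add_apply, add_assoc]
  have hSk : ∀ k, powNorm r₀ (S^[k] U) ≤ 2⁻¹ ^ k * powNorm r₀ U := by
    intro k
    induction k with
    | zero => simp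
    | succ k ih =>
      rw [Function.iterate_succ_apply', pow_succ', mul_assoc]
      exact (hSr₀ _ (hSkm k)).trans (by gcongr)
  set V : X → ℝ≥0∞ := fun x => ⨆ k, W k x with hV
  have hVm : Measurable V := .iSup hWm
  -- Subtraction is truncated, so this says `U ≤ V` almost everywhere. The error `S^[k] U` tends to
  -- `0` in the norm where `U` is known to be finite.
  have hdiff : powNorm r₀ (fun x => U x - V x) = 0 := by
    have hle : ∀ k : ℕ, powNorm r₀ (fun x => U x - V x) ≤ 2⁻¹ ^ k * powNorm r₀ U := by
      intro k
      refine (powNorm_mono_ae hr₀.le ?_).trans (hSk k)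
      filter_upwards [hUW k] with x hx
      rw [tsub_le_iff_right]
      exact hx.trans (add_le_add le_rfl (le_iSup (fun k => W k x) k))
    have hlim : Filter.Tendsto (fun k : ℕ => (2⁻¹ : ℝ≥0∞) ^ k * powNorm r₀ U) Filter.atTop
        (nhds (0 * powNorm r₀ U)) :=
      ENNReal.Tendsto.mul_const
        (ENNReal.tendsto_pow_atTop_nhds_zero_of_lt_one (by simp)) (Or.inr hU₀)
    rw [zero_mul] at hlim
    exact le_antisymm (ge_of_tendsto' hlim hle) zero_le
  have hUV : ∀ᵐ x, U x ≤ V x :=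
    (ae_eq_zero_of_powNorm_eq_zero hr₀ (hU.sub hVm) hdiff).mono fun x hx => tsub_eq_zero_iff_le.1 hx
  refine ne_top_of_le_ne_top (ENNReal.mul_ne_top (by simp) hHr)
    ((powNorm_mono_ae (by linarith) hUV).trans (powNorm_iSup_le (by linarith) hWm hWmono hWr))

theorem tendsto_lintegral_indicator_of_eventually_notMem {f : X → ℝ≥0∞} (hf : Measurable f)
    (hfi : ∫⁻ x, f x ≠ ⊤) {A : ℕ → Set X} (hA : ∀ k, MeasurableSet (A k))
    (h : ∀ x, ∀ᶠ k in Filter.atTop, x ∉ A k) :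
    Filter.Tendsto (fun k => ∫⁻ x, (A k).indicator f x) Filter.atTop (nhds 0) := by
  have := tendsto_lintegral_of_dominated_convergence (μ := (volume : Measure X))
    (F := fun k => (A k).indicator f) (f := fun _ => 0) f (fun k => hf.indicator (hA k))
    (fun k => Filter.Eventually.of_forall fun x => indicator_le_self _ _ x) hfi
    (Filter.Eventually.of_forall fun x => tendsto_const_nhds.congr'
      ((h x).mono fun k hk => (indicator_of_notMem hk _).symm))
  simpa using this

end PowNorm

/-- In polar coordinates this is the divergent integral of `1 / ρ` over `(1, ∞)`. -/
theorem lintegral_one_lt_norm_rpow_neg {n : ℕ} (hn : 1 ≤ n) :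
    ∫⁻ x in {x : EuclideanSpace ℝ (Fin n) | 1 < ‖x‖}, ENNReal.ofReal (‖x‖ ^ (-(n : ℝ))) = ⊤ := by
  have hms : MeasurableSet {x : EuclideanSpace ℝ (Fin n) | 1 < ‖x‖} :=
    measurableSet_lt measurable_const measurable_norm
  have : Nontrivial (EuclideanSpace ℝ (Fin n)) := by
    apply Module.nontrivial_of_finrank_pos (R := ℝ)
    rw [finrank_euclideanSpace_fin]; omega
  by_contra h
  have hm : Measurable fun x : EuclideanSpace ℝ (Fin n) => ‖x‖ ^ (-(n : ℝ)) := by fun_prop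
  have hint := (lintegral_ofReal_ne_top_iff_integrable (hm.aestronglyMeasurable)
    (Filter.Eventually.of_forall fun x => by positivity)).1 h
  rw [← IntegrableOn, ← integrable_indicator_iff hms] at hint
  have heq : {x : EuclideanSpace ℝ (Fin n) | 1 < ‖x‖}.indicator (fun x => ‖x‖ ^ (-(n : ℝ))) =
      fun x => (Ioi (1 : ℝ)).indicator (fun y => y ^ (-(n : ℝ))) ‖x‖ := by
    ext x; simp [indicator]
  rw [heq, integrable_fun_norm_addHaar volume (f := (Ioi (1 : ℝ)).indicator (fun y => y ^ (-(n : ℝ)))),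
    finrank_euclideanSpace_fin] at hint
  have h2 := hint.mono_set (Ioi_subset_Ioi zero_le_one)
  have h3 : IntegrableOn (fun y : ℝ => y ^ (-1 : ℝ)) (Ioi 1) := by
    refine h2.congr_fun (fun y hy => ?_) measurableSet_Ioi
    have hy0 : 0 < y := zero_lt_one.trans hy
    simp only [smul_eq_mul]
    rw [indicator_of_mem hy, ← Real.rpow_natCast, ← Real.rpow_add hy0]
    congr 1
    push_cast [hn]
    ring
  rw [integrableOn_Ioi_rpow_iff zero_lt_one] at h3
  exact lt_irrefl _ h3

end

/-! ### Lifting the integrability of solutions. -/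

noncomputable section

variable {n : ℕ} {α σ σ₁ σ₂ p q : ℝ}

theorem rieszOp_mono_ae {f g : EuclideanSpace ℝ (Fin n) → ℝ≥0∞} (h : ∀ᵐ y, f y ≤ g y) :
    rieszOp n α σ f ≤ rieszOp n α σ g := fun _ =>
  lintegral_mono_ae (h.mono fun _ hy => mul_le_mul_right hy _)

theorem rieszOp_congr_ae {f g : EuclideanSpace ℝ (Fin n) → ℝ≥0∞} (h : ∀ᵐ y, f y = g y) :
    rieszOp n α σ f = rieszOp n α σ g :=
  le_antisymm (rieszOp_mono_ae (h.mono fun _ hy => hy.le))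
    (rieszOp_mono_ae (h.mono fun _ hy => hy.ge))

theorem rieszOp_add {f g : EuclideanSpace ℝ (Fin n) → ℝ≥0∞} (hf : Measurable f) :
    rieszOp n α σ (f + g) = rieszOp n α σ f + rieszOp n α σ g := by
  ext x
  simp only [rieszOp, Pi.add_apply, mul_add]
  exact lintegral_add_left ((measurable_rieszKernel.comp (measurable_const.prodMk measurable_id)).mul
    hf) _

/-- Stein–Weiss followed by Hölder; it bounds the linearized operator with coefficient `a`. -/
theorem exists_powNorm_rieszOp_mul_le (hα : α ∈ Ioo (0 : ℝ) n) (hσ : σ ∈ Ico 0 α) {t c e : ℝ}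
    (ht : 1 / t ∈ Ioo (0 : ℝ) ((n - α) / n)) (hc : 0 < c) (he : 0 < e)
    (h : 1 / t + (α - σ) / n = 1 / c + 1 / e) :
    ∃ K : ℝ≥0∞, K ≠ ⊤ ∧ ∀ a f : EuclideanSpace ℝ (Fin n) → ℝ≥0∞, Measurable a → Measurable f →
      powNorm t (rieszOp n α σ (fun y => a y * f y)) ≤ K * powNorm c a * powNorm e f := by
  have hm : 0 < 1 / c + 1 / e := by positivity
  obtain ⟨K, hK, hb⟩ := exists_powNorm_rieszOp_le hα hσ (s := (1 / c + 1 / e)⁻¹) ht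
    (by rw [h, one_div, inv_inv])
  refine ⟨K, hK, fun a f ha hf => (hb _ (ha.mul hf)).trans ?_⟩
  rw [mul_assoc]
  gcongr
  exact powNorm_mul_le (inv_pos.2 hm) hc he (by rw [one_div, inv_inv]) ha hf

/-- A potential of a positive function decays no faster than `|x|^(α - n)`, which limits its
integrability. -/
theorem lt_mul_of_powNorm_rieszOp_ne_top (hα : α ∈ Ioo (0 : ℝ) n) (hσ : 0 ≤ σ)
    {f : EuclideanSpace ℝ (Fin n) → ℝ≥0∞} (hf : Measurable f) (hpos : ∀ᵐ y, 0 < f y)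
    {r : ℝ} (hr : 0 < r) (h : powNorm r (rieszOp n α σ f) ≠ ⊤) :
    (n : ℝ) < (n - α) * r := by
  by_contra hcon
  push Not at hcon
  have hn : (0 : ℝ) < n := hα.1.trans hα.2
  have hn1 : 1 ≤ n := by exact_mod_cast hn
  have : Nontrivial (EuclideanSpace ℝ (Fin n)) := by
    apply Module.nontrivial_of_finrank_pos (R := ℝ)
    rw [finrank_euclideanSpace_fin]; omega
  have hβ : 0 < (n : ℝ) - α := sub_pos.2 hα.2
  set J := ∫⁻ y in ball (0 : EuclideanSpace ℝ (Fin n)) 1, f y with hJ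
  -- Only nonvanishing is needed; `J = ⊤` does no harm.
  have hJ0 : J ≠ 0 := by
    rw [hJ, Ne, setLIntegral_eq_zero_iff measurableSet_ball hf]
    intro h0
    have hfalse : ∀ᵐ y : EuclideanSpace ℝ (Fin n), y ∉ ball (0 : EuclideanSpace ℝ (Fin n)) 1 := by
      filter_upwards [h0, hpos] with y h1 h2 h3
      exact h2.ne' (h1 h3)
    have := measure_eq_zero_iff_ae_notMem.2 hfalse
    exact (measure_ball_pos volume (0 : EuclideanSpace ℝ (Fin n)) one_pos).ne' this
  set c := ENNReal.ofReal (2 ^ (-((n : ℝ) - α))) * J with hc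
  have hc0 : c ≠ 0 := mul_ne_zero (by rw [Ne, ENNReal.ofReal_eq_zero, not_le]; positivity) hJ0
  have hlow : ∀ x : EuclideanSpace ℝ (Fin n), 1 < ‖x‖ →
      c * ENNReal.ofReal (‖x‖ ^ (-((n : ℝ) - α))) ≤ rieszOp n α σ f x := by
    intro x hx
    calc c * ENNReal.ofReal (‖x‖ ^ (-((n : ℝ) - α)))
        = ENNReal.ofReal ((2 * ‖x‖) ^ (-((n : ℝ) - α))) * J := by
          rw [hc, Real.mul_rpow (by norm_num) (norm_nonneg _), ENNReal.ofReal_mul (by positivity)]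
          ring
      _ = ∫⁻ y in ball (0 : EuclideanSpace ℝ (Fin n)) 1,
            ENNReal.ofReal ((2 * ‖x‖) ^ (-((n : ℝ) - α))) * f y :=
          (lintegral_const_mul' _ _ ENNReal.ofReal_ne_top).symm
      _ ≤ ∫⁻ y in ball (0 : EuclideanSpace ℝ (Fin n)) 1, rieszKernel n α σ x y * f y := by
          refine setLIntegral_mono_ae' measurableSet_ball ?_
          have hne : ∀ᵐ y : EuclideanSpace ℝ (Fin n), y ≠ 0 :=
            compl_mem_ae_iff.2 (measure_singleton 0)
          filter_upwards [hne] with y hy0 hy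
          gcongr
          rw [mem_ball_zero_iff] at hy
          rw [rieszKernel_eq_mul, ← ENNReal.ofReal_mul (by positivity)]
          apply ENNReal.ofReal_le_ofReal
          have hxy : 0 < ‖x - y‖ := by
            have := norm_sub_norm_le x y
            linarith
          have hxy2 : ‖x - y‖ ≤ 2 * ‖x‖ := by
            have := norm_sub_le x y
            linarith
          -- For `‖y‖ < 1 < ‖x‖` the kernel is at least `(2 * ‖x‖) ^ (α - n)`, as the weight is at
          -- least `1` there.
          have h1 : (2 * ‖x‖) ^ (-((n : ℝ) - α)) ≤ ‖x - y‖ ^ (-((n : ℝ) - α)) :=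
            Real.rpow_le_rpow_of_nonpos hxy hxy2 (by linarith)
          have h2 : 1 ≤ ‖y‖ ^ (-σ) :=
            Real.one_le_rpow_of_pos_of_le_one_of_nonpos (norm_pos_iff.2 hy0) hy.le (by linarith)
          exact h1.trans (le_mul_of_one_le_right (by positivity) h2)
      _ ≤ rieszOp n α σ f x := setLIntegral_le_lintegral _ _
  refine (powNorm_ne_top_iff hr).1 h ?_
  rw [eq_top_iff]
  have hms : MeasurableSet {x : EuclideanSpace ℝ (Fin n) | 1 < ‖x‖} :=
    measurableSet_lt measurable_const measurable_norm
  calc (⊤ : ℝ≥0∞) = c ^ r * ⊤ := by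
        rw [ENNReal.mul_top]
        rw [Ne, ENNReal.rpow_eq_zero_iff_of_pos hr]
        exact hc0
    _ = c ^ r * ∫⁻ x in {x : EuclideanSpace ℝ (Fin n) | 1 < ‖x‖},
          ENNReal.ofReal (‖x‖ ^ (-(n : ℝ))) := by rw [lintegral_one_lt_norm_rpow_neg hn1]
    _ = ∫⁻ x in {x : EuclideanSpace ℝ (Fin n) | 1 < ‖x‖},
          c ^ r * ENNReal.ofReal (‖x‖ ^ (-(n : ℝ))) := (lintegral_const_mul _ (by fun_prop)).symm
    _ ≤ ∫⁻ x in {x : EuclideanSpace ℝ (Fin n) | 1 < ‖x‖}, rieszOp n α σ f x ^ r := by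
        refine setLIntegral_mono' hms fun x hx => ?_
        have hx0 : (1 : ℝ) < ‖x‖ := hx
        refine le_trans ?_ (ENNReal.rpow_le_rpow (hlow x hx) hr.le)
        rw [ENNReal.mul_rpow_of_nonneg c (ENNReal.ofReal (‖x‖ ^ (-((n : ℝ) - α)))) hr.le]
        refine mul_le_mul_right ?_ _
        rw [ENNReal.ofReal_rpow_of_nonneg (by positivity) hr.le, ← Real.rpow_mul (norm_nonneg _)]
        apply ENNReal.ofReal_le_ofReal
        exact Real.rpow_le_rpow_of_exponent_le hx0.le (by nlinarith)
    _ ≤ ∫⁻ x, rieszOp n α σ f x ^ r := setLIntegral_le_lintegral _ _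

/-- Integrability of a solution at the critical exponents lifts to other pairs of exponents with
the same difference of reciprocals. -/
theorem powNorm_ne_top_of_isFixedPoint (hα : α ∈ Ioo (0 : ℝ) n) (hσ₁ : σ₁ ∈ Ico 0 α)
    (hσ₂ : σ₂ ∈ Ico 0 α) (hp : 1 < p) (hq : 1 < q)
    {U V : EuclideanSpace ℝ (Fin n) → ℝ≥0∞} (hU : Measurable U) (hV : Measurable V)
    (hVtop : ∀ x, V x ≠ ⊤) (hUeq : ∀ᵐ x, U x = rieszOp n α σ₁ (fun y => V y ^ q) x)
    (hVeq : ∀ᵐ x, V x = rieszOp n α σ₂ (fun y => U y ^ p) x) {r₀ s₀ r s : ℝ}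
    (hr₀ : 1 / r₀ ∈ Ioo (0 : ℝ) ((n - α) / n)) (hs₀ : 1 / s₀ ∈ Ioo (0 : ℝ) ((n - α) / n))
    (hr : 1 / r ∈ Ioo (0 : ℝ) ((n - α) / n)) (hs : 1 / s ∈ Ioo (0 : ℝ) ((n - α) / n))
    (h₁ : 1 / r₀ + (α - σ₁) / n = q * (1 / s₀)) (h₂ : 1 / s₀ + (α - σ₂) / n = p * (1 / r₀))
    (hrs : 1 / r - 1 / s = 1 / r₀ - 1 / s₀) (hUr₀ : powNorm r₀ U ≠ ⊤) (hVs₀ : powNorm s₀ V ≠ ⊤) :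
    powNorm r U ≠ ⊤ ∧ powNorm s V ≠ ⊤ := by
  have hn : (0 : ℝ) < n := hα.1.trans hα.2
  have pr₀ : 0 < r₀ := one_div_pos.1 hr₀.1
  have ps₀ : 0 < s₀ := one_div_pos.1 hs₀.1
  have pr : 0 < r := one_div_pos.1 hr.1
  have ps : 0 < s := one_div_pos.1 hs.1
  have hq1 : 0 < q - 1 := by linarith
  have hp1 : 0 < p - 1 := by linarith
  have hr1 : 1 ≤ r := by
    have hα1 : ((n : ℝ) - α) / n < 1 := by rw [div_lt_one hn]; linarith [hα.1]
    exact ((div_lt_one pr).1 (hr.2.trans hα1)).le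
  have eq1 : 1 / (s₀ / (q - 1)) = (q - 1) * (1 / s₀) := by field_simp
  have ep1 : 1 / (r₀ / (p - 1)) = (p - 1) * (1 / r₀) := by field_simp
  -- The exponents match because `h₁`, `h₂` hold at the critical pair and `hrs` keeps the difference
  -- of reciprocals; `L₁`, `L₂` are the same bounds at the critical pair itself.
  obtain ⟨K₁, hK₁, hb₁⟩ := exists_powNorm_rieszOp_mul_le (c := s₀ / (q - 1)) (e := s) hα hσ₁ hr
    (by positivity) ps (by rw [eq1]; linarith)
  obtain ⟨K₂, hK₂, hb₂⟩ := exists_powNorm_rieszOp_mul_le (c := r₀ / (p - 1)) (e := r) hα hσ₂ hs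
    (by positivity) pr (by rw [ep1]; linarith)
  obtain ⟨L₁, hL₁, hc₁⟩ := exists_powNorm_rieszOp_mul_le (c := s₀ / (q - 1)) (e := s₀) hα hσ₁ hr₀
    (by positivity) ps₀ (by rw [eq1]; linarith)
  obtain ⟨L₂, hL₂, hc₂⟩ := exists_powNorm_rieszOp_mul_le (c := r₀ / (p - 1)) (e := r₀) hα hσ₂ hs₀
    (by positivity) pr₀ (by rw [ep1]; linarith)
  set b : EuclideanSpace ℝ (Fin n) → ℝ≥0∞ := fun x => U x ^ (p - 1) with hb
  have hbm : Measurable b := hU.pow_const _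
  set B := powNorm (r₀ / (p - 1)) b with hB
  have hBtop : B ≠ ⊤ := by
    rw [hB, hb, powNorm_rpow hp1, mul_div_cancel₀ _ hp1.ne']
    exact ENNReal.rpow_ne_top_of_nonneg hp1.le hUr₀
  -- Off `A k` both `V` and the support are bounded by `k`. Since `V` is finite, each point
  -- eventually leaves `A k`, so the coefficient restricted to `A k` tends to `0` in norm.
  set A : ℕ → Set (EuclideanSpace ℝ (Fin n)) :=
    fun k => {x | (k : ℝ≥0∞) < V x} ∪ {x | (k : ℝ) < ‖x‖} with hA
  have hAm : ∀ k, MeasurableSet (A k) := fun k =>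
    (measurableSet_lt measurable_const hV).union (measurableSet_lt measurable_const measurable_norm)
  have hAev : ∀ x, ∀ᶠ k in Filter.atTop, x ∉ A k := by
    intro x
    obtain ⟨k₁, hk₁⟩ := ENNReal.exists_nat_gt (hVtop x)
    obtain ⟨k₂, hk₂⟩ := exists_nat_gt ‖x‖
    filter_upwards [Filter.eventually_ge_atTop k₁, Filter.eventually_ge_atTop k₂] with k h1 h2
    rintro (h3 | h3)
    · exact absurd (hk₁.trans_le (by exact_mod_cast h1)) (not_lt.2 (le_of_lt h3))
    · exact absurd (hk₂.trans_le (by exact_mod_cast h2)) (not_lt.2 (le_of_lt h3))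
  set a : ℕ → EuclideanSpace ℝ (Fin n) → ℝ≥0∞ :=
    fun k => (A k).indicator fun x => V x ^ (q - 1) with ha
  have ham : ∀ k, Measurable (a k) := fun k => (hV.pow_const _).indicator (hAm k)
  have hatend : Filter.Tendsto (fun k => powNorm (s₀ / (q - 1)) (a k)) Filter.atTop (nhds 0) := by
    have h1 := tendsto_lintegral_indicator_of_eventually_notMem (hV.pow_const s₀)
      ((powNorm_ne_top_iff ps₀).1 hVs₀) hAm hAev
    have h2 : ∀ k, powNorm (s₀ / (q - 1)) (a k) =
        (∫⁻ x, (A k).indicator (fun x => V x ^ s₀) x) ^ (1 / (s₀ / (q - 1))) := by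
      intro k
      unfold powNorm
      congr 1
      congr 1 with x
      rw [ha]
      by_cases hx : x ∈ A k
      · simp only [indicator_of_mem hx]
        rw [← ENNReal.rpow_mul, mul_div_cancel₀ _ hq1.ne']
      · simp only [indicator_of_notMem hx]
        rw [ENNReal.zero_rpow_of_pos (by positivity)]
    simp_rw [h2]
    have h3 := (ENNReal.continuous_rpow_const (y := 1 / (s₀ / (q - 1)))).tendsto 0
    rw [ENNReal.zero_rpow_of_pos (by positivity)] at h3
    exact h3.comp h1
  -- The sum of constants makes a single `k` serve for the contraction in both norms.
  obtain ⟨k, hk⟩ : ∃ k, (K₁ * K₂ * B + L₁ * L₂ * B) * powNorm (s₀ / (q - 1)) (a k) ≤ 2⁻¹ := by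
    have h1 := ENNReal.Tendsto.const_mul (a := K₁ * K₂ * B + L₁ * L₂ * B) hatend
      (Or.inr (by finiteness))
    rw [mul_zero] at h1
    exact (h1.eventually_le_const (by simp : (0 : ℝ≥0∞) < 2⁻¹)).exists
  set S : (EuclideanSpace ℝ (Fin n) → ℝ≥0∞) → EuclideanSpace ℝ (Fin n) → ℝ≥0∞ := fun f =>
    rieszOp n α σ₁ (fun y => a k y * rieszOp n α σ₂ (fun z => b z * f z) y) with hS
  have hSm₂ : ∀ f, Measurable f → Measurable (rieszOp n α σ₂ (fun z => b z * f z)) := fun f hf =>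
    measurable_rieszOp (hbm.mul hf)
  have hSm : ∀ f, Measurable f → Measurable (S f) := fun f hf =>
    measurable_rieszOp ((ham k).mul (hSm₂ f hf))
  have hmono : ∀ f g, (∀ᵐ x, f x ≤ g x) → S f ≤ S g := fun f g hfg =>
    rieszOp_mono_ae (Filter.Eventually.of_forall fun y =>
      mul_le_mul_right (rieszOp_mono_ae (hfg.mono fun z hz => mul_le_mul_right hz _) y) _)
  have hadd : ∀ f g, Measurable f → Measurable g → S (f + g) ≤ S f + S g := by
    intro f g hf hg
    refine le_of_eq ?_
    have e1 : (fun z => b z * (f + g) z) = (fun z => b z * f z) + fun z => b z * g z := by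
      ext z; simp [mul_add]
    simp only [hS]
    rw [e1, rieszOp_add (f := fun z => b z * f z) (hbm.mul hf), ← rieszOp_add
      (f := fun y => a k y * rieszOp n α σ₂ (fun z => b z * f z) y) ((ham k).mul (hSm₂ f hf))]
    congr 1
    ext y
    simp [mul_add]
  have hSr : ∀ f, Measurable f → powNorm r (S f) ≤ 2⁻¹ * powNorm r f := by
    intro f hf
    calc powNorm r (S f) ≤ K₁ * powNorm (s₀ / (q - 1)) (a k) *
          powNorm s (rieszOp n α σ₂ (fun z => b z * f z)) := hb₁ _ _ (ham k) (hSm₂ f hf)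
      _ ≤ K₁ * powNorm (s₀ / (q - 1)) (a k) * (K₂ * B * powNorm r f) := by
          gcongr; exact hb₂ _ _ hbm hf
      _ = K₁ * K₂ * B * powNorm (s₀ / (q - 1)) (a k) * powNorm r f := by ring
      _ ≤ (K₁ * K₂ * B + L₁ * L₂ * B) * powNorm (s₀ / (q - 1)) (a k) * powNorm r f := by
          gcongr; exact le_self_add
      _ ≤ _ := by gcongr
  have hSr₀ : ∀ f, Measurable f → powNorm r₀ (S f) ≤ 2⁻¹ * powNorm r₀ f := by
    intro f hf
    calc powNorm r₀ (S f) ≤ L₁ * powNorm (s₀ / (q - 1)) (a k) *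
          powNorm s₀ (rieszOp n α σ₂ (fun z => b z * f z)) := hc₁ _ _ (ham k) (hSm₂ f hf)
      _ ≤ L₁ * powNorm (s₀ / (q - 1)) (a k) * (L₂ * B * powNorm r₀ f) := by
          gcongr; exact hc₂ _ _ hbm hf
      _ = L₁ * L₂ * B * powNorm (s₀ / (q - 1)) (a k) * powNorm r₀ f := by ring
      _ ≤ (K₁ * K₂ * B + L₁ * L₂ * B) * powNorm (s₀ / (q - 1)) (a k) * powNorm r₀ f := by
          gcongr; exact le_add_self
      _ ≤ _ := by gcongr
  have hpow : ∀ (c : ℝ≥0∞) {e : ℝ}, 1 < e → c ^ (e - 1) * c = c ^ e := by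
    intro c e he
    nth_rewrite 2 [← ENNReal.rpow_one c]
    rw [← ENNReal.rpow_add_of_nonneg _ _ (by linarith) zero_le_one, sub_add_cancel]
  have hbU : (fun z => b z * U z) = fun z => U z ^ p := by
    ext z; exact hpow _ hp
  set w : EuclideanSpace ℝ (Fin n) → ℝ≥0∞ := (A k)ᶜ.indicator fun y => V y ^ q with hw
  have hwm : Measurable w := (hV.pow_const _).indicator (hAm k).compl
  -- In fact an equality: `V ^ q = a k * V + w`, with `V` replaced by its own equation inside the
  -- first term.
  have hUS : ∀ᵐ x, U x ≤ S U x + rieszOp n α σ₁ w x := by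
    filter_upwards [hUeq] with x hx
    rw [hx]
    refine le_of_eq ?_
    have e1 : S U = rieszOp n α σ₁ (fun y => a k y * V y) := by
      simp only [hS, hbU]
      refine rieszOp_congr_ae ?_
      filter_upwards [hVeq] with y hy
      rw [hy]
    rw [e1, ← Pi.add_apply (rieszOp n α σ₁ _), ← rieszOp_add (f := fun y => a k y * V y) ((ham k).mul hV)]
    congr 1
    ext y
    simp only [Pi.add_apply, ha, hw]
    by_cases hy : y ∈ A k
    · rw [indicator_of_mem hy, indicator_of_notMem (by simpa using hy), add_zero, hpow _ hq]
    · rw [indicator_of_notMem hy, indicator_of_mem (by simpa using hy), zero_mul, zero_add]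
  have hm : 0 < 1 / r + (α - σ₁) / n :=
    add_pos hr.1 (div_pos (sub_pos.2 hσ₁.2) hn)
  obtain ⟨M, hM, hMb⟩ := exists_powNorm_rieszOp_le hα hσ₁ (s := (1 / r + (α - σ₁) / n)⁻¹) hr
    (by rw [one_div, inv_inv])
  have hHr : powNorm r (rieszOp n α σ₁ w) ≠ ⊤ := by
    refine ne_top_of_le_ne_top (ENNReal.mul_ne_top hM ?_) (hMb w hwm)
    set m := (1 / r + (α - σ₁) / n)⁻¹ with hmdef
    have hm0 : 0 < m := inv_pos.2 hm
    rw [powNorm_ne_top_iff hm0]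
    have hle : ∀ x, w x ^ m ≤ (closedBall (0 : EuclideanSpace ℝ (Fin n)) k).indicator
        (fun _ => ((k : ℝ≥0∞) ^ q) ^ m) x := by
      intro x
      by_cases hx : x ∈ A k
      · rw [hw, indicator_of_notMem (by simpa using hx), ENNReal.zero_rpow_of_pos hm0]
        exact zero_le
      · have hx' : V x ≤ k ∧ ‖x‖ ≤ k := by
          simpa [hA, not_or] using hx
        rw [hw, indicator_of_mem (by simpa using hx),
          indicator_of_mem (mem_closedBall_zero_iff.2 hx'.2)]
        gcongr
        exact hx'.1
    refine ne_top_of_le_ne_top ?_ (lintegral_mono hle)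
    rw [lintegral_indicator_const measurableSet_closedBall]
    refine ENNReal.mul_ne_top ?_ measure_closedBall_lt_top.ne
    exact ENNReal.rpow_ne_top_of_nonneg hm0.le
      (ENNReal.rpow_ne_top_of_nonneg (by linarith) (ENNReal.natCast_ne_top k))
  have hUr : powNorm r U ≠ ⊤ := powNorm_ne_top_of_contraction hSm hmono hadd hr1 pr₀ hSr hSr₀ hU
    (measurable_rieszOp hwm) hUS hUr₀ hHr
  refine ⟨hUr, ?_⟩
  rw [powNorm_congr_ae hVeq, ← hbU]
  exact ne_top_of_le_ne_top (ENNReal.mul_ne_top (ENNReal.mul_ne_top hK₂ hBtop) hUr)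
    (hb₂ b U hbm hU)

end

/-! ### Exponent relations and the full integrability intervals. -/

noncomputable section

variable {n : ℕ} {α σ σ₁ σ₂ p q : ℝ}

/-- One nonlinear step through an equation of the system, free of the constraint tying `r` to `s` in
the lifting. -/
theorem powNorm_rieszOp_rpow_ne_top (hα : α ∈ Ioo (0 : ℝ) n) (hσ : σ ∈ Ico 0 α) {t c e : ℝ}
    (ht : 1 / t ∈ Ioo (0 : ℝ) ((n - α) / n)) (he : 0 < e)
    (h : 1 / t + (α - σ) / n = e * (1 / c)) {f : EuclideanSpace ℝ (Fin n) → ℝ≥0∞}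
    (hf : Measurable f) (hfc : powNorm c f ≠ ⊤) :
    powNorm t (rieszOp n α σ (fun y => f y ^ e)) ≠ ⊤ := by
  obtain ⟨K, hK, hb⟩ := exists_powNorm_rieszOp_le hα hσ (s := c / e) ht
    (by rw [h, one_div_div]; ring)
  refine ne_top_of_le_ne_top (ENNReal.mul_ne_top hK ?_) (hb _ (hf.pow_const e))
  rw [powNorm_rpow he, mul_div_cancel₀ _ he.ne']
  exact ENNReal.rpow_ne_top_of_nonneg he.le hfc

theorem memLp_ofReal_iff_powNorm_ne_top {X : Type*} [MeasureSpace X] {u : X → ℝ} {U : X → ℝ≥0∞}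
    (hu : AEMeasurable u) (h : ∀ᵐ x, ‖u x‖ₑ = U x) {r : ℝ} (hr : 0 < r) :
    MemLp u (ENNReal.ofReal r) volume ↔ powNorm r U ≠ ⊤ := by
  have : eLpNorm u (ENNReal.ofReal r) volume = powNorm r U := by
    rw [eLpNorm_eq_lintegral_rpow_enorm_toReal (by simpa using hr) ENNReal.ofReal_ne_top,
      ENNReal.toReal_ofReal hr.le]
    exact powNorm_congr_ae (f := fun x => ‖u x‖ₑ) h
  rw [MemLp, this, lt_top_iff_ne_top]
  exact and_iff_right hu.aestronglyMeasurable

theorem potential_rpow_eq_rieszOp {v : EuclideanSpace ℝ (Fin n) → ℝ}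
    {V : EuclideanSpace ℝ (Fin n) → ℝ≥0∞} (hpos : ∀ᵐ y, 0 < v y)
    (hV : ∀ᵐ y, V y = ENNReal.ofReal (v y)) (e : ℝ) (x : EuclideanSpace ℝ (Fin n)) :
    potential n α σ (fun y => v y ^ e) x = rieszOp n α σ (fun y => V y ^ e) x := by
  refine lintegral_congr_ae ?_
  filter_upwards [hpos, hV] with y h1 h2
  rw [h2, ENNReal.ofReal_rpow_of_pos h1, rieszKernel, div_eq_mul_inv, mul_comm,
    ENNReal.ofReal_mul (by positivity)]

/-- Together with `p₀_add_eq`, this is the scaling balance making `n / q₀` and `n / p₀` compatible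
with both equations under Stein–Weiss. -/
theorem q₀_add_eq (hpq : p * q - 1 ≠ 0) :
    q₀ α σ₁ σ₂ p q + (α - σ₁) = q * p₀ α σ₁ σ₂ p q := by
  unfold q₀ p₀
  rw [div_add' _ _ _ hpq, ← mul_div_assoc, div_left_inj' hpq]
  ring

theorem p₀_add_eq (hpq : p * q - 1 ≠ 0) :
    p₀ α σ₁ σ₂ p q + (α - σ₂) = p * q₀ α σ₁ σ₂ p q := by
  unfold q₀ p₀
  rw [div_add' _ _ _ hpq, ← mul_div_assoc, div_left_inj' hpq]
  ring

theorem p₀_pos (hσ₁ : σ₁ < α) (hσ₂ : σ₂ < α) (hp : 1 < p) (hq : 1 < q) :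
    0 < p₀ α σ₁ σ₂ p q :=
  div_pos (by nlinarith) (by nlinarith)

/-- The numerators differ by `(σ₁ - σ₂) * (p - 1) + (α - σ₂) * (q - p)`. -/
theorem p₀_le_q₀ (hσ₂ : σ₂ < α) (hp : 1 < p) (hpq : p ≤ q) (hσ : σ₂ ≤ σ₁) :
    p₀ α σ₁ σ₂ p q ≤ q₀ α σ₁ σ₂ p q := by
  unfold p₀ q₀
  refine div_le_div_of_nonneg_right ?_ (by nlinarith)
  nlinarith [mul_nonneg (sub_nonneg.2 hσ) (sub_nonneg.2 hp.le),
    mul_nonneg (sub_nonneg.2 hσ₂.le) (sub_nonneg.2 hpq)]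

/-- The integrability intervals of a solution, for `[0, ∞]`-valued measurable functions. -/
theorem powNorm_ne_top_of_isSolution (hα : α ∈ Ioo (0 : ℝ) n) (hσ₁ : σ₁ ∈ Ico 0 α)
    (hσ₂ : σ₂ ∈ Ico 0 α) (hp : 1 < p) (hpq : p ≤ q) (hσ : σ₂ ≤ σ₁)
    {U V : EuclideanSpace ℝ (Fin n) → ℝ≥0∞} (hU : Measurable U) (hV : Measurable V)
    (hVpos : ∀ᵐ x, 0 < V x) (hVtop : ∀ x, V x ≠ ⊤)
    (hUeq : ∀ᵐ x, U x = rieszOp n α σ₁ (fun y => V y ^ q) x)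
    (hVeq : ∀ᵐ x, V x = rieszOp n α σ₂ (fun y => U y ^ p) x)
    (hU₀ : powNorm (n / q₀ α σ₁ σ₂ p q) U ≠ ⊤) (hV₀ : powNorm (n / p₀ α σ₁ σ₂ p q) V ≠ ⊤) :
    (∀ r : ℝ, 1 / r ∈ Ioo (0 : ℝ) ((n - α) / n) → powNorm r U ≠ ⊤) ∧
    (∀ s : ℝ, 1 / s ∈ Ioo (0 : ℝ) (min ((n - α) / n) ((p * (n - α) - (α - σ₂)) / n)) →
      powNorm s V ≠ ⊤) := by
  have hn : (0 : ℝ) < n := hα.1.trans hα.2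
  have hq : 1 < q := hp.trans_le hpq
  have hpq1 : p * q - 1 ≠ 0 := by nlinarith
  have hP := p₀_pos (α := α) (σ₁ := σ₁) (σ₂ := σ₂) hσ₁.2 hσ₂.2 hp hq
  have hPQ := p₀_le_q₀ (α := α) (σ₁ := σ₁) (σ₂ := σ₂) hσ₂.2 hp hpq hσ
  have eQ := q₀_add_eq (α := α) (σ₁ := σ₁) (σ₂ := σ₂) hpq1
  have eP := p₀_add_eq (α := α) (σ₁ := σ₁) (σ₂ := σ₂) hpq1
  set P := p₀ α σ₁ σ₂ p q
  set Q := q₀ α σ₁ σ₂ p q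
  have hQ : 0 < Q := hP.trans_le hPQ
  -- Stein–Weiss needs the critical exponent of `U` in its range; this holds because `U` is the
  -- potential of a positive function and lies in `L^(n/Q)`.
  have hQn : Q < n - α := by
    have h1 := lt_mul_of_powNorm_rieszOp_ne_top hα hσ₁.1 (hV.pow_const q)
      (hVpos.mono fun x hx => ENNReal.rpow_pos hx (hVtop x)) (div_pos hn hQ)
      (by rwa [← powNorm_congr_ae hUeq])
    rw [← mul_div_assoc, lt_div_iff₀ hQ, mul_comm] at h1
    exact lt_of_mul_lt_mul_right h1 hn.le
  have hσ₁n : 0 < (α - σ₁) / n := div_pos (sub_pos.2 hσ₁.2) hn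
  have hσ₂n : 0 < (α - σ₂) / n := div_pos (sub_pos.2 hσ₂.2) hn
  have hPn : 0 < P / n := div_pos hP hn
  have hPQn : P / n ≤ Q / n := by gcongr
  have hQn' : Q / n < (n - α) / n := by gcongr
  have eQn : Q / n + (α - σ₁) / n = q * (P / n) := by rw [← add_div, eQ, mul_div_assoc]
  have ePn : P / n + (α - σ₂) / n = p * (Q / n) := by rw [← add_div, eP, mul_div_assoc]
  have hlift : ∀ r s : ℝ, 1 / r - 1 / s = Q / n - P / n → 0 < 1 / s → 1 / r < (n - α) / n →
      powNorm r U ≠ ⊤ ∧ powNorm s V ≠ ⊤ := by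
    intro r s hrs hs hr
    refine powNorm_ne_top_of_isFixedPoint (r₀ := n / Q) (s₀ := n / P) hα hσ₁ hσ₂ hp hq hU hV hVtop
      hUeq hVeq ?_ ?_ ⟨by linarith, hr⟩ ⟨hs, by linarith⟩ ?_ ?_ ?_ hU₀ hV₀ <;>
    simp only [one_div_div]
    · exact ⟨by linarith, hQn'⟩
    · exact ⟨hPn, by linarith⟩
    · exact eQn
    · exact ePn
    · exact hrs
  have hUall : ∀ r : ℝ, 1 / r ∈ Ioo (0 : ℝ) ((n - α) / n) → powNorm r U ≠ ⊤ := by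
    rintro r ⟨hr0, hr1⟩
    rcases lt_or_ge (Q / n - P / n) (1 / r) with h | h
    · exact (hlift r (1 / (1 / r - (Q / n - P / n))) (by rw [one_div_one_div]; ring)
        (by rw [one_div_one_div]; linarith) hr1).1
    -- Here the partner exponent of `V` would not be positive. Instead `V` is lifted to `1 / y`,
    -- admissible since `y < P / n`, and the equation for `U` is applied once.
    · set y := (1 / r + (α - σ₁) / n) / q with hy
      have hy0 : 0 < y := div_pos (by linarith) (by linarith)
      have hyq : q * y = 1 / r + (α - σ₁) / n := mul_div_cancel₀ _ (by linarith)
      have hyP : y < P / n := by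
        refine lt_of_mul_lt_mul_left (a := q) ?_ (by linarith)
        linarith
      have hVy := (hlift (1 / (y + (Q / n - P / n))) (1 / y)
        (by rw [one_div_one_div, one_div_one_div]; ring)
        (by rwa [one_div_one_div]) (by rw [one_div_one_div]; linarith)).2
      rw [powNorm_congr_ae hUeq]
      exact powNorm_rieszOp_rpow_ne_top hα hσ₁ ⟨hr0, hr1⟩ (by linarith)
        (by rw [one_div_one_div, hyq]) hV hVy
  refine ⟨hUall, ?_⟩
  rintro s ⟨hs0, hs1⟩
  rw [lt_min_iff] at hs1
  set x := (1 / s + (α - σ₂) / n) / p with hx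
  have hx0 : 0 < x := div_pos (by linarith) (by linarith)
  have hxp : p * x = 1 / s + (α - σ₂) / n := mul_div_cancel₀ _ (by linarith)
  -- This is where the second entry of the minimum is used: `1 / x` must be an exponent already
  -- known for `U`.
  have hx1 : x < (n - α) / n := by
    refine lt_of_mul_lt_mul_left (a := p) ?_ (by linarith)
    have h2 := hs1.2
    rw [sub_div, mul_div_assoc] at h2
    linarith
  have hUx := hUall (1 / x) (by rw [one_div_one_div]; exact ⟨hx0, hx1⟩)
  rw [powNorm_congr_ae hVeq]
  exact powNorm_rieszOp_rpow_ne_top hα hσ₂ ⟨hs0, hs1.1⟩ (by linarith)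
    (by rw [one_div_one_div, hxp]) hU hUx

end
end HardySobolev

theorem mainTheorem4 (n : ℕ) (hn : 3 ≤ n) (α σ₁ σ₂ p q : ℝ)
    (hα : α ∈ Set.Ioo (0 : ℝ) (n : ℝ))
    (hσ₁ : σ₁ ∈ Set.Ico (0 : ℝ) α) (hσ₂ : σ₂ ∈ Set.Ico (0 : ℝ) α)
    (hp : 1 < p) (hqp : p ≤ q) (hσ : σ₂ ≤ σ₁)
    (u v : EuclideanSpace ℝ (Fin n) → ℝ)
    (huv : HardySobolev.IsPositiveIntegrableSolution n α σ₁ σ₂ p q u v) :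
    (∀ r : ℝ, 1 / r ∈ Set.Ioo (0 : ℝ) (((n : ℝ) - α) / n) →
      MemLp u (ENNReal.ofReal r) volume) ∧
    (∀ s : ℝ, 1 / s ∈ Set.Ioo (0 : ℝ)
        (min (((n : ℝ) - α) / n) ((p * ((n : ℝ) - α) - (α - σ₂)) / n)) →
      MemLp v (ENNReal.ofReal s) volume) := by
  have hu := huv.aemeasurable_u
  have hv := huv.aemeasurable_v
  have hn0 : (0 : ℝ) < n := hα.1.trans hα.2
  have hq : 1 < q := hp.trans_le hqp
  have hP := HardySobolev.p₀_pos (α := α) (σ₁ := σ₁) (σ₂ := σ₂) hσ₁.2 hσ₂.2 hp hq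
  have hQ := hP.trans_le (HardySobolev.p₀_le_q₀ (α := α) (σ₁ := σ₁) (σ₂ := σ₂) hσ₂.2 hp hqp hσ)
  -- Measurable representatives change neither the potentials nor the norms.
  have hUu : ∀ᵐ x, ENNReal.ofReal (hu.mk u x) = ENNReal.ofReal (u x) :=
    hu.ae_eq_mk.mono fun x hx => by rw [hx]
  have hVv : ∀ᵐ x, ENNReal.ofReal (hv.mk v x) = ENNReal.ofReal (v x) :=
    hv.ae_eq_mk.mono fun x hx => by rw [hx]
  have hUe : ∀ᵐ x, ‖u x‖ₑ = ENNReal.ofReal (hu.mk u x) := by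
    filter_upwards [hUu, huv.pos_u] with x h1 h2
    rw [h1, Real.enorm_of_nonneg h2.le]
  have hVe : ∀ᵐ x, ‖v x‖ₑ = ENNReal.ofReal (hv.mk v x) := by
    filter_upwards [hVv, huv.pos_v] with x h1 h2
    rw [h1, Real.enorm_of_nonneg h2.le]
  obtain ⟨h1, h2⟩ := HardySobolev.powNorm_ne_top_of_isSolution
    (U := fun x => ENNReal.ofReal (hu.mk u x)) (V := fun x => ENNReal.ofReal (hv.mk v x))
    hα hσ₁ hσ₂ hp hqp hσ hu.measurable_mk.ennreal_ofReal hv.measurable_mk.ennreal_ofReal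
    (by
      filter_upwards [hVv, huv.pos_v] with x h1 h2
      rw [h1]
      exact ENNReal.ofReal_pos.2 h2)
    (fun _ => ENNReal.ofReal_ne_top)
    (by
      filter_upwards [hUu, huv.eq_u] with x h1 h2
      rw [h1, h2, HardySobolev.potential_rpow_eq_rieszOp huv.pos_v hVv])
    (by
      filter_upwards [hVv, huv.eq_v] with x h1 h2
      rw [h1, h2, HardySobolev.potential_rpow_eq_rieszOp huv.pos_u hUu])
    ((HardySobolev.memLp_ofReal_iff_powNorm_ne_top hu hUe (div_pos hn0 hQ)).1 huv.memLp_u)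
    ((HardySobolev.memLp_ofReal_iff_powNorm_ne_top hv hVe (div_pos hn0 hP)).1 huv.memLp_v)
  exact ⟨fun r hr => (HardySobolev.memLp_ofReal_iff_powNorm_ne_top hu hUe
      (one_div_pos.1 hr.1)).2 (h1 r hr),
    fun s hs => (HardySobolev.memLp_ofReal_iff_powNorm_ne_top hv hVe
      (one_div_pos.1 hs.1)).2 (h2 s hs)⟩
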